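/- Let $0<R\le\infty$ and let $f(z)=\sum_{n=0}^\infty a_nz^n$ be a non-constant analytic function for $|z|<R$, with maximum term $\mu_f(r)=\max_{n\ge 0}|a_n|r^n$ for $0\le r<R$. Let $0\le\rho<R$ and let $h:[\rho,R)\to[0,\infty)$ be a continuous increasing (not necessarily strictly increasing) function with $\int_\rho^R\frac{h(r)}{r}\,dr=\infty$; suppose that $\lim_{r\to R}h(r)>1$ and $\lim_{r\to R}h(r)\mu_f(r)>1$ (limits in $[0,\infty]$). A set $E\subset[0,R)$ is said to be of finite $h$-logarithmic measure if $\int_{E\cap[\rho,R)}\frac{h(r)}{r}\,dr<\infty$. Let $(X_n)_{n\ge0}$ be an independent sequence of centred complex random variables on a probability space $(\Omega,\mathcal A,\mathbb P)$ that is subgaussian, i.e. there are constants $K,\tau>0$ such that $\mathbb P(|X_n|>t)\le Ke^{-t^2/\tau^2}$ for all $n\ge0$ and all $t\ge0$. Then, almost surely, $\sum_{n=0}^\infty a_nX_nz^n$ defines an analytic function for $|z|<R$. Moreover, for every $\delta>0$, there exist an open set $E\subset[0,R)$ of finite $h$-logarithmic measure and a constant $C>0$ (both independent of $\omega\in\Omega$)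 such that, almost surely, there exists some $r_0\in(\rho,R)$ such that $$\max_{|z|=r}\Big|\sum_{n=0}^\infty a_nX_nz^n\Big|\le C\,h(r)^{\frac12}\mu_f(r)\big(\log h(r)\big)^{\frac34+\delta}\big(\log(h(r)\mu_f(r))\big)^{\frac14}\big(\log\log(h(r)\mu_f(r))\big)^{1+\delta}$$ for all $r$ with $r_0\le r<R$ and $r\notin E$. -/

import Mathlib

open MeasureTheory ProbabilityTheory Filter Topology

namespace RandomPowerSeries

/-- The open disc of radius `R` about `0` in the complex plane, where `R` may be `⊤`. -/
def disc (R : EReal) : Set ℂ := {z | ((‖z‖ : ℝ) : EReal) < R}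

/-- The half-open interval of real numbers `r` with `ρ ≤ r < R`, where `R` may be `⊤`. -/
def intervalTo (ρ : ℝ) (R : EReal) : Set ℝ := {r | ρ ≤ r ∧ (r : EReal) < R}

/-- The filter on the real line for limits `r → R` from the left; it is `𝓝[<] R` for real `R`
and `atTop` for `R = ⊤`. -/
noncomputable def leftOf (R : EReal) : Filter ℝ := comap (fun r : ℝ => (r : EReal)) (𝓝[<] R)

/-- `u(r)` has a limit in the extended reals as `r → R`, and this limit is greater than `c`. -/
def LimGT (R : EReal) (u : ℝ → ℝ) (c : ℝ) : Prop :=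
  ∃ L : EReal, (c : EReal) < L ∧ Tendsto (fun r => (u r : EReal)) (leftOf R) (𝓝 L)

/-- The power series with coefficients `a` converges for `|z| < R`, and its sum there is the
analytic function `f`. -/
def IsPowerSeriesOn (R : EReal) (a : ℕ → ℂ) (f : ℂ → ℂ) : Prop :=
  AnalyticOnNhd ℂ f (disc R) ∧ ∀ z ∈ disc R, HasSum (fun n => a n * z ^ n) (f z)

/-- The maximum modulus `max_{|z| = r} |g(z)|`. -/
noncomputable def maxModulus (g : ℂ → ℂ) (r : ℝ) : ℝ :=
  sSup ((fun z => ‖g z‖) '' Metric.sphere (0 : ℂ) r)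

/-- The maximum term `max_n |a_n| r^n` of the power series with coefficients `a`. The maximum
is attained for every `0 ≤ r` smaller than the radius of convergence. -/
noncomputable def maxTerm (a : ℕ → ℂ) (r : ℝ) : ℝ := ⨆ n : ℕ, ‖a n‖ * r ^ n

/-- The integral of `h(r) / r` over the part of `E` in `ρ ≤ r < R`. -/
noncomputable def hLogMeasure (ρ : ℝ) (R : EReal) (h : ℝ → ℝ) (E : Set ℝ) : ENNReal :=
  ∫⁻ r in E ∩ intervalTo ρ R, ENNReal.ofReal (h r / r)

/-- A sequence of complex random variables is subgaussian if the tails satisfy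
`P(|X_n| > t) ≤ K exp(-t² / τ²)`, with the same constants for all `n`. -/
def IsSubgaussianSeq {Ω : Type*} [MeasurableSpace Ω] (P : Measure Ω) (X : ℕ → Ω → ℂ) : Prop :=
  ∃ K : ℝ, 0 < K ∧ ∃ τ : ℝ, 0 < τ ∧ ∀ n : ℕ, ∀ t : ℝ, 0 ≤ t →
    P.real {ω | t < ‖X n ω‖} ≤ K * Real.exp (-t ^ 2 / τ ^ 2)

end RandomPowerSeries

namespace RandomPowerSeries

/-! Write `G(r) = ∑ |a n|² r^(2n)`, and regard the normalised weights `|a n|² r^(2n) / G(r)` as a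
probability law on the indices, with mean `m(r)` and variance `V(r)`. The proof compares the random
series with `√G` and then `G` with `μ²`.

Deterministic half. Chebyshev puts at least three quarters of the mass on `O(√V + 1)` indices, so `G
≤ (6√V + 4) μ²` (`moment_le_variance_mul_maxTerm_sq`). Since `r (log G)' = 2m` and `r m' = 2V`, the
Borel-Nevanlinna lemma (`hLogMeasure_growthSet_lt_top`), applied once to `log G` and once to `m`,
bounds `m` by about `h log G` and `V` by about `h m`, up to logarithmic factors and outside an open
set of finite `h`-logarithmic measure. Hence `√V` is about `h (log G)^(1/2)`, and `G` is bounded by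
`h μ² (log (hμ))^(1/2)` times logarithmic factors (`exists_moment_bound`).

Probabilistic half. At a fixed point of a circle the random sum is subgaussian with variance proxy
of order `G`, so its `p`-th moment is at most `2 (C √(pG))^p` (`lintegral_norm_sum_pow_le`).
Cauchy's formula for the `p`-th power passes from the circle of radius `r` to the disc of radius `s
< r` at the cost of a factor `r / (r - s)` in probability, and Markov's inequality contributes `exp
(-p)` (`measure_large_le`).

The halves meet on a grid `q j` where `log h + log G` takes consecutive integer values `k`. Take `s`
to the left of `q j` with `q j / (q j - s) = k² h(q j)`, and `p` about `log (k⁴ h(q j))`: the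
failure probabilities are at most `2 / k²`, so Borel-Cantelli applies, and the skipped intervals
`(s, q j)` have summable `h`-logarithmic measure. Any other `r` lies below some `s` whose grid value
exceeds that at `r` by at most 1, so `G` and `h` grow by at most a factor `e`. The factor `√p` adds
`(log h)^(1/2) (log log (hμ))^(1/2)` to `√G`, which produces the stated exponents. -/

/-! ### Subgaussian tails and moment generating functions. -/

theorem exp_le_add_exp_sq (x : ℝ) : Real.exp x ≤ x + Real.exp (x ^ 2) := by
  rcases le_total 1 x with hx | hx
  · have : Real.exp x ≤ Real.exp (x ^ 2) := Real.exp_le_exp.2 (by nlinarith)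
    linarith
  rcases le_total (-1) x with hx' | hx'
  · have h1 : |x| ≤ 1 := abs_le.2 ⟨hx', hx⟩
    have h2 := Real.abs_exp_sub_one_sub_id_le h1
    have h3 := Real.add_one_le_exp (x ^ 2)
    have h4 := (abs_le.1 h2).2
    linarith
  · have h1 : Real.exp x ≤ 1 := Real.exp_le_one_iff.2 (by linarith)
    have h3 := Real.add_one_le_exp (x ^ 2)
    nlinarith

/-- Convexity of the exponential along the segment from `0` to `s`. -/
theorem exp_mul_le_one_add {c s : ℝ} (hc0 : 0 ≤ c) (hc1 : c ≤ 1) :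
    Real.exp (c * s) ≤ 1 + c * (Real.exp s - 1) := by
  have := convexOn_exp.2 (Set.mem_univ 0) (Set.mem_univ s) (sub_nonneg.2 hc1) hc0 (by ring)
  simp only [smul_eq_mul, mul_zero, zero_add, Real.exp_zero, mul_one] at this
  linarith

section
variable {Ω : Type*} [MeasurableSpace Ω]

/-- Layer-cake formula. The scale `2 τ²` is twice that of the tail, so the tail becomes `K e^(-2t)`,
which still leaves `K e^(-t)` against the weight `e^t`. -/
theorem lintegral_exp_sq_le {P : Measure Ω} [IsProbabilityMeasure P] {Y : Ω → ℝ}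
    (hY : Measurable Y) (hY0 : ∀ ω, 0 ≤ Y ω) {K τ : ℝ} (hK : 0 < K) (hτ : 0 < τ)
    (htail : ∀ t : ℝ, 0 ≤ t → P.real {ω | t < Y ω} ≤ K * Real.exp (-t ^ 2 / τ ^ 2)) :
    ∫⁻ ω, ENNReal.ofReal (Real.exp (Y ω ^ 2 / (2 * τ ^ 2))) ∂P ≤ ENNReal.ofReal (1 + K) := by
  have hf0 : ∀ ω, 0 ≤ Y ω ^ 2 / (2 * τ ^ 2) := fun ω => by positivity
  have key := lintegral_comp_eq_lintegral_meas_lt_mul P (f := fun ω => Y ω ^ 2 / (2 * τ ^ 2))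
    (g := Real.exp) (Eventually.of_forall hf0) (by fun_prop)
    (fun t _ => Real.continuous_exp.intervalIntegrable _ _)
    (Eventually.of_forall fun t => (Real.exp_pos t).le)
  have e1 : ∀ ω, ENNReal.ofReal (Real.exp (Y ω ^ 2 / (2 * τ ^ 2))) =
      1 + ENNReal.ofReal (∫ t in (0 : ℝ)..(Y ω ^ 2 / (2 * τ ^ 2)), Real.exp t) := by
    intro ω
    rw [integral_exp, Real.exp_zero, ← ENNReal.ofReal_one, ← ENNReal.ofReal_add zero_le_one
      (sub_nonneg.2 (Real.one_le_exp (hf0 ω)))]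
    congr 1; ring
  have e2 : ∫⁻ t in Set.Ioi (0 : ℝ), P {a | t < Y a ^ 2 / (2 * τ ^ 2)} * ENNReal.ofReal (Real.exp t)
      ≤ ENNReal.ofReal K := by
    calc _ ≤ ∫⁻ t in Set.Ioi (0 : ℝ), ENNReal.ofReal (K * Real.exp (-t)) := by
          refine setLIntegral_mono (by fun_prop) fun t ht => ?_
          have ht : 0 < t := ht
          have hset : {a | t < Y a ^ 2 / (2 * τ ^ 2)} = {a | Real.sqrt (2 * τ ^ 2 * t) < Y a} := by
            ext a
            simp only [Set.mem_ofPred_eq]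
            rw [lt_div_iff₀ (by positivity), Real.sqrt_lt (by positivity) (hY0 a), mul_comm]
          have h1 := htail (Real.sqrt (2 * τ ^ 2 * t)) (Real.sqrt_nonneg _)
          rw [Real.sq_sqrt (by positivity)] at h1
          have h2 : -(2 * τ ^ 2 * t) / τ ^ 2 = -t + -t := by field_simp; ring
          rw [h2] at h1
          rw [hset, ← ENNReal.ofReal_toReal (measure_ne_top P _),
            ← ENNReal.ofReal_mul ENNReal.toReal_nonneg]
          apply ENNReal.ofReal_le_ofReal
          calc _ ≤ K * Real.exp (-t + -t) * Real.exp t :=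
                mul_le_mul_of_nonneg_right h1 (Real.exp_pos t).le
            _ = K * Real.exp (-t) := by rw [mul_assoc, ← Real.exp_add]; congr 2; ring
      _ = ENNReal.ofReal K := by
          rw [← ofReal_integral_eq_lintegral_ofReal]
          · rw [integral_const_mul, integral_exp_neg_Ioi_zero, mul_one]
          · exact (integrableOn_exp_neg_Ioi 0).const_mul K
          · exact Eventually.of_forall fun t => by positivity
  rw [lintegral_congr e1, lintegral_add_left measurable_const, key,
    ENNReal.ofReal_add zero_le_one hK.le, ENNReal.ofReal_one]
  simpa using e2

/-- For `t² ≤ 1`, centring kills the linear term of `e^(ty) ≤ ty + e^(t²y²)`, and convexity makes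
the rest linear in `t²`. For `t² ≥ 1` the crude `ty ≤ t²/4 + y²` is enough, because `B ≥ 1`. -/
theorem hasSubgaussianMGF_of_integral_exp_sq_le {P : Measure Ω} [IsProbabilityMeasure P]
    {Y : Ω → ℝ} (hY : Measurable Y) (hint : Integrable (fun ω => Real.exp (Y ω ^ 2)) P) {B : NNReal}
    (hB : ∫ ω, Real.exp (Y ω ^ 2) ∂P ≤ B) (hc : ∫ ω, Y ω ∂P = 0) :
    HasSubgaussianMGF Y (2 * B) P := by
  have hbound : ∀ t y : ℝ, Real.exp (t * y) ≤ Real.exp (t ^ 2 / 4) * Real.exp (y ^ 2) := by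
    intro t y
    rw [← Real.exp_add]
    exact Real.exp_le_exp.2 (by nlinarith [sq_nonneg (t / 2 - y)])
  have hI : ∀ t : ℝ, Integrable (fun ω => Real.exp (t * Y ω)) P := by
    intro t
    refine (hint.const_mul (Real.exp (t ^ 2 / 4))).mono' (by fun_prop) (Eventually.of_forall ?_)
    intro ω
    rw [Real.norm_eq_abs, abs_of_pos (Real.exp_pos _)]
    exact hbound t _
  have hYI : Integrable Y P := by
    refine hint.mono' (by fun_prop) (Eventually.of_forall fun ω => ?_)
    have h3 := Real.add_one_le_exp (Y ω ^ 2)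
    rw [Real.norm_eq_abs]
    nlinarith [sq_abs (Y ω), sq_nonneg (|Y ω| - 1)]
  have hB1 : 1 ≤ (B : ℝ) := by
    refine le_trans ?_ hB
    calc (1 : ℝ) = ∫ ω, (1 : ℝ) ∂P := by simp
      _ ≤ _ := integral_mono (integrable_const _) hint fun ω => Real.one_le_exp (sq_nonneg _)
  refine ⟨hI, fun t => ?_⟩
  have hgoal : ((2 * B : NNReal) : ℝ) * t ^ 2 / 2 = t ^ 2 * B := by push_cast; ring
  rw [hgoal, mgf]
  rcases le_total (t ^ 2) 1 with ht | ht
  · calc ∫ ω, Real.exp (t * Y ω) ∂P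
        ≤ ∫ ω, (t * Y ω + (1 - t ^ 2 + t ^ 2 * Real.exp (Y ω ^ 2))) ∂P := by
          refine integral_mono (hI t) (by fun_prop) fun ω => ?_
          have h1 := exp_le_add_exp_sq (t * Y ω)
          have h2 := exp_mul_le_one_add (s := Y ω ^ 2) (sq_nonneg t) ht
          rw [mul_pow] at h1
          dsimp only
          linarith
      _ = 1 - t ^ 2 + t ^ 2 * ∫ ω, Real.exp (Y ω ^ 2) ∂P := by
          rw [integral_add (by fun_prop) (by fun_prop), integral_add (by fun_prop) (by fun_prop),
            integral_const_mul, integral_const_mul, hc]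
          simp
      _ ≤ t ^ 2 * B + 1 := by nlinarith [mul_le_mul_of_nonneg_left hB (sq_nonneg t)]
      _ ≤ Real.exp (t ^ 2 * B) := Real.add_one_le_exp _
  · calc ∫ ω, Real.exp (t * Y ω) ∂P
        ≤ ∫ ω, Real.exp (t ^ 2 / 4) * Real.exp (Y ω ^ 2) ∂P :=
          integral_mono (hI t) (hint.const_mul _) fun ω => hbound t _
      _ ≤ Real.exp (t ^ 2 / 4) * B := by
          rw [integral_const_mul]
          exact mul_le_mul_of_nonneg_left hB (Real.exp_pos _).le
      _ ≤ Real.exp (t ^ 2 / 4) * Real.exp (B - 1) := by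
          refine mul_le_mul_of_nonneg_left ?_ (Real.exp_pos _).le
          have := Real.add_one_le_exp ((B : ℝ) - 1)
          linarith
      _ ≤ Real.exp (t ^ 2 * B) := by
          rw [← Real.exp_add]
          exact Real.exp_le_exp.2 (by nlinarith)

/-- A centred subgaussian sequence has real linear images with uniformly subgaussian moment
generating functions. -/
theorem exists_hasSubgaussianMGF_re {P : Measure Ω} [IsProbabilityMeasure P] {X : ℕ → Ω → ℂ}
    (hX_meas : ∀ n, Measurable (X n)) (hX_centred : ∀ n, ∫ ω, X n ω ∂P = 0)
    (hX : IsSubgaussianSeq P X) :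
    ∃ c : NNReal, (∀ n (u : ℂ),
        HasSubgaussianMGF (fun ω => (u * X n ω).re) (⟨‖u‖ ^ 2, sq_nonneg _⟩ * c) P) ∧
      ∀ n, Integrable (X n) P ∧ ∫ ω, ‖X n ω‖ ∂P ≤ c := by
  obtain ⟨K, hK, τ, hτ, htail⟩ := hX
  have hK1 : (0 : ℝ) ≤ 1 + K := by linarith
  set β : ℝ := Real.sqrt 2 * τ with hβ
  have hβ0 : 0 < β := by positivity
  have hβ2 : β ^ 2 = 2 * τ ^ 2 := by rw [hβ, mul_pow, Real.sq_sqrt zero_le_two]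
  have hl : ∀ n, ∫⁻ ω, ENNReal.ofReal (Real.exp (‖X n ω‖ ^ 2 / β ^ 2)) ∂P
      ≤ ENNReal.ofReal (1 + K) := fun n => by
    rw [hβ2]
    exact lintegral_exp_sq_le (hX_meas n).norm (fun ω => norm_nonneg _) hK hτ (htail n)
  have hI : ∀ n, Integrable (fun ω => Real.exp (‖X n ω‖ ^ 2 / β ^ 2)) P := fun n => by
    refine ⟨by have := hX_meas n; fun_prop, ?_⟩
    rw [hasFiniteIntegral_iff_ofReal (Eventually.of_forall fun ω => (Real.exp_pos _).le)]
    exact (hl n).trans_lt ENNReal.ofReal_lt_top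
  have hIle : ∀ n, ∫ ω, Real.exp (‖X n ω‖ ^ 2 / β ^ 2) ∂P ≤ 1 + K := fun n => by
    rw [integral_eq_lintegral_of_nonneg_ae (Eventually.of_forall fun ω => (Real.exp_pos _).le)
      (hI n).1]
    exact ENNReal.toReal_le_of_le_ofReal hK1 (hl n)
  have hpt : ∀ n ω, ‖X n ω‖ ≤ β * Real.exp (‖X n ω‖ ^ 2 / β ^ 2) := fun n ω => by
    have h1 := Real.add_one_le_exp (‖X n ω‖ ^ 2 / β ^ 2)
    have h2 : ‖X n ω‖ = β * (‖X n ω‖ / β) := by field_simp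
    have h3 : ‖X n ω‖ / β ≤ Real.exp (‖X n ω‖ ^ 2 / β ^ 2) := by
      rw [← div_pow] at h1 ⊢
      nlinarith [sq_nonneg (‖X n ω‖ / β - 1), sq_nonneg (‖X n ω‖ / β)]
    calc ‖X n ω‖ = β * (‖X n ω‖ / β) := h2
      _ ≤ _ := mul_le_mul_of_nonneg_left h3 hβ0.le
  have hXI : ∀ n, Integrable (X n) P := fun n =>
    ((hI n).const_mul β).mono' (hX_meas n).aestronglyMeasurable (Eventually.of_forall (hpt n))
  -- The first summand is the variance proxy, the second bounds the first absolute moment; their sum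
  -- serves for both.
  refine ⟨⟨β ^ 2 * (2 * (1 + K)) + β * (1 + K), by positivity⟩, fun n u => ?_, fun n =>
    ⟨hXI n, ?_⟩⟩
  -- Normalising the direction makes the proxy scale with `‖u‖ ^ 2`. For `u = 0` the inverse is 0
  -- and `v = 0`, so only `‖v‖ ≤ 1` is claimed.
  · set v : ℂ := (‖u‖ : ℂ)⁻¹ * u with hv
    have hv1 : ‖v‖ ≤ 1 := by
      rw [hv, norm_mul, norm_inv, Complex.norm_real, norm_norm]
      exact inv_mul_le_one
    have huv : u = ‖u‖ * v := by
      rcases eq_or_ne u 0 with rfl | hu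
      · simp
      · have : (‖u‖ : ℂ) ≠ 0 := by simpa using hu
        rw [hv]; field_simp
    have hm := hX_meas n
    have hYle : ∀ ω, Real.exp ((β⁻¹ * (v * X n ω).re) ^ 2) ≤ Real.exp (‖X n ω‖ ^ 2 / β ^ 2) := by
      intro ω
      apply Real.exp_le_exp.2
      rw [mul_pow, inv_pow, inv_mul_eq_div]
      refine div_le_div_of_nonneg_right ?_ (by positivity)
      rw [sq_le_sq, abs_norm]
      calc _ ≤ ‖v * X n ω‖ := Complex.abs_re_le_norm _
        _ ≤ 1 * ‖X n ω‖ := by rw [norm_mul]; gcongr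
        _ = _ := one_mul _
    have hYI : Integrable (fun ω => Real.exp ((β⁻¹ * (v * X n ω).re) ^ 2)) P :=
      (hI n).mono' (by fun_prop) (Eventually.of_forall fun ω => by
        rw [Real.norm_eq_abs, abs_of_pos (Real.exp_pos _)]; exact hYle ω)
    have h0 : ∫ ω, β⁻¹ * (v * X n ω).re ∂P = 0 := by
      rw [integral_const_mul]
      have : ∫ ω, (v * X n ω).re ∂P = (∫ ω, v * X n ω ∂P).re :=
        integral_re ((hXI n).const_mul v)
      rw [this, integral_const_mul, hX_centred]
      simp
    have hs := hasSubgaussianMGF_of_integral_exp_sq_le (B := ⟨1 + K, hK1⟩) (by fun_prop) hYI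
      ((integral_mono hYI (hI n) hYle).trans (hIle n)) h0
    have hs2 := hs.const_mul (‖u‖ * β)
    have heq : (fun ω => ‖u‖ * β * (β⁻¹ * (v * X n ω).re)) = fun ω => (u * X n ω).re := by
      funext ω
      have h1 : (u * X n ω).re = ‖u‖ * (v * X n ω).re := by
        conv_lhs => rw [huv]
        rw [mul_assoc, Complex.re_ofReal_mul]
      rw [h1]; field_simp
    rw [heq] at hs2
    refine ⟨hs2.1, fun t => (hs2.2 t).trans (Real.exp_le_exp.2 ?_)⟩
    gcongr ?_ * _ / _
    change (‖u‖ * β) ^ 2 * (2 * (1 + K)) ≤ ‖u‖ ^ 2 * (β ^ 2 * (2 * (1 + K)) + β * (1 + K))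
    have : 0 ≤ ‖u‖ ^ 2 * (β * (1 + K)) := by positivity
    nlinarith
  · calc ∫ ω, ‖X n ω‖ ∂P ≤ ∫ ω, β * Real.exp (‖X n ω‖ ^ 2 / β ^ 2) ∂P :=
          integral_mono (hXI n).norm ((hI n).const_mul β) (hpt n)
      _ ≤ β * (1 + K) := by
          rw [integral_const_mul]; exact mul_le_mul_of_nonneg_left (hIle n) hβ0.le
      _ ≤ β ^ 2 * (2 * (1 + K)) + β * (1 + K) := by
          have : 0 ≤ β ^ 2 * (2 * (1 + K)) := by positivity
          linarith

end

/-! ### Moments of random sums and their size on discs. -/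

section
variable {Ω : Type*} [MeasurableSpace Ω]

/-- Reduces the modulus to real linear images, where the moment generating function is controlled:
`|w| ≤ |re w| + |im w|`, then `xy ≤ (x² + y²) / 2`, with `im w` written as the real part of `-i w`.
-/
theorem exp_norm_le (l : ℝ) (hl : 0 ≤ l) (w : ℂ) : Real.exp (l * ‖w‖) ≤
    (1 / 2) * (Real.exp (2 * l * w.re) + Real.exp (-(2 * l) * w.re) +
      (Real.exp (2 * l * (-Complex.I * w).re) + Real.exp (-(2 * l) * (-Complex.I * w).re))) := by
  have him : (-Complex.I * w).re = w.im := by simp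
  rw [him]
  have habs : ∀ x : ℝ, Real.exp (2 * l * |x|) ≤ Real.exp (2 * l * x) + Real.exp (-(2 * l) * x) := by
    intro x
    rcases abs_cases x with ⟨h, _⟩ | ⟨h, _⟩ <;> rw [h]
    · linarith [Real.exp_pos (-(2 * l) * x)]
    · rw [show 2 * l * -x = -(2 * l) * x by ring]; linarith [Real.exp_pos (2 * l * x)]
  have h1 : Real.exp (l * ‖w‖) ≤ Real.exp (l * |w.re|) * Real.exp (l * |w.im|) := by
    rw [← Real.exp_add, ← mul_add]
    exact Real.exp_le_exp.2 (mul_le_mul_of_nonneg_left (Complex.norm_le_abs_re_add_abs_im w) hl)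
  have h2 : ∀ x : ℝ, Real.exp (2 * l * |x|) = Real.exp (l * |x|) ^ 2 := by
    intro x; rw [← Real.exp_nat_mul]; congr 1; push_cast; ring
  have h3 := habs w.re
  have h4 := habs w.im
  rw [h2] at h3 h4
  nlinarith [sq_nonneg (Real.exp (l * |w.re|) - Real.exp (l * |w.im|))]

/-- Independence adds the variance proxies. The growth `√p ^ p` in `p` is what later allows `p` to
be chosen as a logarithm. -/
theorem lintegral_norm_sum_pow_le {P : Measure Ω} [IsProbabilityMeasure P] {X : ℕ → Ω → ℂ}
    (hX_indep : iIndepFun X P) {c : NNReal}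
    (hX : ∀ n (u : ℂ),
        HasSubgaussianMGF (fun ω => (u * X n ω).re) (⟨‖u‖ ^ 2, sq_nonneg _⟩ * c) P)
    (u : ℕ → ℂ) (N : ℕ) {S : ℝ} (hS : 0 < S)
    (hu : ∑ n ∈ Finset.range N, ‖u n‖ ^ 2 ≤ S ^ 2) {p : ℕ} (hp : 0 < p) :
    ∫⁻ ω, ENNReal.ofReal (‖∑ n ∈ Finset.range N, u n * X n ω‖ ^ p) ∂P ≤
      ENNReal.ofReal (2 * Real.exp (2 * c * p) * (Real.sqrt p * S) ^ p) := by
  have hp' : (0 : ℝ) < p := by exact_mod_cast hp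
  -- With this `l` the exponent `c S² (2l)² / 2` equals `2cp`, of the same order as the exponent
  -- lost in `x ^ p ≤ e^(px)`.
  set l : ℝ := Real.sqrt p / S with hl
  have hl0 : 0 < l := div_pos (Real.sqrt_pos.2 hp') hS
  have hsub : ∀ e : ℂ, ‖e‖ = 1 → HasSubgaussianMGF
      (fun ω => (e * ∑ n ∈ Finset.range N, u n * X n ω).re)
      (∑ n ∈ Finset.range N, ⟨‖e * u n‖ ^ 2, sq_nonneg _⟩ * c) P := by
    intro e he
    have hind : iIndepFun (fun n ω => (e * u n * X n ω).re) P :=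
      hX_indep.comp (fun n x => (e * u n * x).re) (fun n => by fun_prop)
    have := HasSubgaussianMGF.sum_of_iIndepFun hind (s := Finset.range N)
      (fun n _ => hX n (e * u n))
    convert this using 2 with ω
    rw [Finset.mul_sum, Complex.re_sum]
    simp only [mul_assoc]
  have hmgf : ∀ e : ℂ, ‖e‖ = 1 → ∀ t : ℝ, t ^ 2 = (2 * l) ^ 2 →
      ∫ ω, Real.exp (t * (e * ∑ n ∈ Finset.range N, u n * X n ω).re) ∂P ≤
        Real.exp (2 * c * p) := by
    intro e he t ht
    refine ((hsub e he).mgf_le t).trans (Real.exp_le_exp.2 ?_)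
    rw [ht]
    push_cast
    have h1 : ∑ n ∈ Finset.range N, (‖e * u n‖ ^ 2 * (c : ℝ)) ≤ S ^ 2 * c := by
      rw [← Finset.sum_mul]
      simp only [norm_mul, he, one_mul]
      exact mul_le_mul_of_nonneg_right hu c.2
    have h2 : l ^ 2 * S ^ 2 = p := by
      rw [hl, div_pow, Real.sq_sqrt hp'.le]; field_simp
    change (∑ n ∈ Finset.range N, (‖e * u n‖ ^ 2 * (c : ℝ))) * (2 * l) ^ 2 / 2 ≤ _
    calc _ ≤ S ^ 2 * c * (2 * l) ^ 2 / 2 := by gcongr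
      _ = 2 * c * (l ^ 2 * S ^ 2) := by ring
      _ = _ := by rw [h2]
  have hint : ∀ e : ℂ, ‖e‖ = 1 → ∀ t : ℝ,
      Integrable (fun ω => Real.exp (t * (e * ∑ n ∈ Finset.range N, u n * X n ω).re)) P :=
    fun e he t => (hsub e he).integrable_exp_mul t
  have i1 := hint 1 (by simp) (2 * l)
  have i2 := hint 1 (by simp) (-(2 * l))
  have i3 := hint (-Complex.I) (by simp) (2 * l)
  have i4 := hint (-Complex.I) (by simp) (-(2 * l))
  have m1 := hmgf 1 (by simp) (2 * l) rfl
  have m2 := hmgf 1 (by simp) (-(2 * l)) (by ring)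
  have m3 := hmgf (-Complex.I) (by simp) (2 * l) rfl
  have m4 := hmgf (-Complex.I) (by simp) (-(2 * l)) (by ring)
  simp only [one_mul] at i1 i2 m1 m2
  have hpt : ∀ ω, ‖∑ n ∈ Finset.range N, u n * X n ω‖ ^ p ≤ (Real.sqrt p * S) ^ p * ((1 / 2) *
      (Real.exp (2 * l * (∑ n ∈ Finset.range N, u n * X n ω).re) +
        Real.exp (-(2 * l) * (∑ n ∈ Finset.range N, u n * X n ω).re) +
      (Real.exp (2 * l * (-Complex.I * ∑ n ∈ Finset.range N, u n * X n ω).re) +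
        Real.exp (-(2 * l) * (-Complex.I * ∑ n ∈ Finset.range N, u n * X n ω).re)))) := by
    intro ω
    set w := ∑ n ∈ Finset.range N, u n * X n ω
    refine le_trans ?_ (mul_le_mul_of_nonneg_left (exp_norm_le l hl0.le w) (by positivity))
    have h1 : ‖w‖ = (Real.sqrt p * S) * (l * ‖w‖ / p) := by
      have h2 : Real.sqrt p * Real.sqrt p = p := Real.mul_self_sqrt hp'.le
      rw [hl]; field_simp
      rw [sq, h2]
    have h3 : l * ‖w‖ / p ≤ Real.exp (l * ‖w‖ / p) := by
      linarith [Real.add_one_le_exp (l * ‖w‖ / p)]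
    calc ‖w‖ ^ p = (Real.sqrt p * S) ^ p * (l * ‖w‖ / p) ^ p := by rw [← mul_pow, ← h1]
      _ ≤ (Real.sqrt p * S) ^ p * (Real.exp (l * ‖w‖ / p)) ^ p := by gcongr
      _ = _ := by
        rw [← Real.exp_nat_mul]; congr 2; field_simp
  have hI : Integrable (fun ω => (Real.sqrt p * S) ^ p * ((1 / 2) *
      (Real.exp (2 * l * (∑ n ∈ Finset.range N, u n * X n ω).re) +
        Real.exp (-(2 * l) * (∑ n ∈ Finset.range N, u n * X n ω).re) +
      (Real.exp (2 * l * (-Complex.I * ∑ n ∈ Finset.range N, u n * X n ω).re) +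
        Real.exp (-(2 * l) * (-Complex.I * ∑ n ∈ Finset.range N, u n * X n ω).re))))) P :=
    (((i1.add i2).add (i3.add i4)).const_mul _).const_mul _
  calc _ ≤ ∫⁻ ω, ENNReal.ofReal ((Real.sqrt p * S) ^ p * ((1 / 2) *
      (Real.exp (2 * l * (∑ n ∈ Finset.range N, u n * X n ω).re) +
        Real.exp (-(2 * l) * (∑ n ∈ Finset.range N, u n * X n ω).re) +
      (Real.exp (2 * l * (-Complex.I * ∑ n ∈ Finset.range N, u n * X n ω).re) +
        Real.exp (-(2 * l) * (-Complex.I * ∑ n ∈ Finset.range N, u n * X n ω).re))))) ∂P :=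
        lintegral_mono fun ω => ENNReal.ofReal_le_ofReal (hpt ω)
    _ = ENNReal.ofReal (∫ ω, _ ∂P) :=
        (ofReal_integral_eq_lintegral_ofReal hI
          (Eventually.of_forall fun ω => le_trans (by positivity) (hpt ω))).symm
    _ ≤ _ := by
        apply ENNReal.ofReal_le_ofReal
        have hadd := integral_add (i1.add i2) (i3.add i4)
        simp only [Pi.add_apply] at hadd
        rw [integral_const_mul, integral_const_mul, hadd, integral_add i1 i2, integral_add i3 i4,
          mul_comm (2 * Real.exp _)]
        refine mul_le_mul_of_nonneg_left ?_ (by positivity)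
        linarith

/-- Cauchy's formula for `F ^ p`, as a bound for `F` inside a circle by its mean over it. -/
theorem norm_pow_mul_le_integral {F : ℂ → ℂ} (hF : Differentiable ℂ F) (p : ℕ) {r s : ℝ}
    (hsr : s < r) {z : ℂ} (hz : ‖z‖ ≤ s) :
    ENNReal.ofReal (‖F z‖ ^ p * (2 * Real.pi * (r - s) / r)) ≤
      ∫⁻ θ in Set.Ioc 0 (2 * Real.pi), ENNReal.ofReal (‖F (circleMap 0 r θ)‖ ^ p) := by
  have hs0 : 0 ≤ s := (norm_nonneg z).trans hz
  have hr0 : 0 < r := hs0.trans_lt hsr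
  have hcont : Continuous fun θ : ℝ => ‖F (circleMap 0 r θ)‖ ^ p :=
    ((hF.continuous.comp (continuous_circleMap 0 r)).norm).pow p
  have hball : z ∈ Metric.ball (0 : ℂ) r := by simpa using hz.trans_lt hsr
  have hC := DiffContOnCl.circleIntegral_sub_inv_smul (f := fun w => F w ^ p) (c := (0 : ℂ))
    (R := r) (w := z) (hF.pow p).diffContOnCl hball
  have hn := congrArg norm hC
  have h1 : ‖∮ w in C(0, r), (w - z)⁻¹ • F w ^ p‖ ≤
      ∫ θ in (0 : ℝ)..(2 * Real.pi), r / (r - s) * ‖F (circleMap 0 r θ)‖ ^ p := by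
    unfold circleIntegral
    refine intervalIntegral.norm_integral_le_of_norm_le (by positivity)
      (Eventually.of_forall fun θ _ => ?_)
      ((hcont.const_mul _).intervalIntegrable _ _)
    rw [deriv_circleMap, norm_smul, norm_smul, norm_mul, norm_inv, norm_pow]
    simp only [Complex.norm_I, mul_one]
    have h2 : ‖circleMap 0 r θ‖ = r := by simp [abs_of_pos hr0]
    rw [h2]
    have h3 : r - s ≤ ‖circleMap 0 r θ - z‖ := by
      have := norm_sub_norm_le (circleMap 0 r θ) z
      rw [h2] at this
      linarith
    have h4 : 0 < r - s := sub_pos.2 hsr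
    rw [← mul_assoc, div_eq_mul_inv]
    gcongr
  rw [← ofReal_integral_eq_lintegral_ofReal
    ((hcont.intervalIntegrable 0 (2 * Real.pi)).1) (Eventually.of_forall fun θ => by positivity),
    ← intervalIntegral.integral_of_le (by positivity)]
  apply ENNReal.ofReal_le_ofReal
  rw [intervalIntegral.integral_const_mul, hn, norm_smul, norm_pow] at h1
  have h5 : ‖(2 * Real.pi * Complex.I : ℂ)‖ = 2 * Real.pi := by
    simp [abs_of_pos Real.pi_pos]
  rw [h5] at h1
  have h4 : 0 < r - s := sub_pos.2 hsr
  calc _ = (r - s) / r * (2 * Real.pi * ‖F z‖ ^ p) := by ring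
    _ ≤ (r - s) / r * (r / (r - s) * ∫ θ in (0 : ℝ)..(2 * Real.pi), ‖F (circleMap 0 r θ)‖ ^ p) := by
        gcongr
    _ = _ := by field_simp

theorem summable_norm_mul_pow_mono {b : ℕ → ℂ} {r : ℝ} (hb : Summable fun n => ‖b n‖ * r ^ n)
    {s : ℝ} (hs : 0 ≤ s) (hsr : s ≤ r) : Summable fun n => ‖b n‖ * s ^ n :=
  hb.of_nonneg_of_le (fun n => by positivity) fun n => by gcongr

/-- The partial sums are entire, so Cauchy's bound holds for each of them. Stating the limit as a
`liminf` prepares for Fatou's lemma in `ω`. -/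
theorem norm_tsum_pow_mul_le_liminf {b : ℕ → ℂ} (p : ℕ) {r s : ℝ} (hsr : s < r)
    (hb : Summable fun n => ‖b n‖ * r ^ n) {z : ℂ} (hz : ‖z‖ ≤ s) :
    ENNReal.ofReal (‖∑' n, b n * z ^ n‖ ^ p * (2 * Real.pi * (r - s) / r)) ≤
      liminf (fun N => ∫⁻ θ in Set.Ioc 0 (2 * Real.pi),
        ENNReal.ofReal (‖∑ n ∈ Finset.range N, b n * circleMap 0 r θ ^ n‖ ^ p)) atTop := by
  have hsum : Summable fun n => b n * z ^ n := by
    apply Summable.of_norm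
    simp only [norm_mul, norm_pow]
    exact summable_norm_mul_pow_mono hb (norm_nonneg z) (hz.trans hsr.le)
  have hlim : Tendsto (fun N => ENNReal.ofReal (‖∑ n ∈ Finset.range N, b n * z ^ n‖ ^ p *
      (2 * Real.pi * (r - s) / r))) atTop
      (𝓝 (ENNReal.ofReal (‖∑' n, b n * z ^ n‖ ^ p * (2 * Real.pi * (r - s) / r)))) :=
    ENNReal.tendsto_ofReal
      (((hsum.hasSum.tendsto_sum_nat.norm).pow p).mul_const _)
  rw [← hlim.liminf_eq]
  refine liminf_le_liminf (Eventually.of_forall fun N => ?_)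
  exact norm_pow_mul_le_integral (F := fun w => ∑ n ∈ Finset.range N, b n * w ^ n)
    (by fun_prop) p hsr hz

/-- The probability that a subgaussian random power series is large on a disc. -/
theorem measure_large_le {P : Measure Ω} [IsProbabilityMeasure P] {X : ℕ → Ω → ℂ}
    (hX_meas : ∀ n, Measurable (X n)) (hX_indep : iIndepFun X P) {c : NNReal}
    (hX : ∀ n (u : ℂ),
        HasSubgaussianMGF (fun ω => (u * X n ω).re) (⟨‖u‖ ^ 2, sq_nonneg _⟩ * c) P)
    (a : ℕ → ℂ) {r s S : ℝ} (hr : 0 < r) (hsr : s < r) (hS : 0 < S)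
    (ha : ∀ N, ∑ n ∈ Finset.range N, ‖a n‖ ^ 2 * r ^ (2 * n) ≤ S ^ 2) {p : ℕ} (hp : 0 < p) :
    ∃ A : Set Ω, P A ≤ ENNReal.ofReal (2 * (Real.exp (-p) * (r / (r - s)))) ∧
      ∀ ω ∉ A, (Summable fun n => ‖a n * X n ω‖ * r ^ n) →
        ∀ z : ℂ, ‖z‖ ≤ s → ‖∑' n, a n * X n ω * z ^ n‖ ≤
          Real.exp (2 * c + 1) * (Real.sqrt p * S) := by
  have hp' : (0 : ℝ) < p := by exact_mod_cast hp
  have hrs : 0 < r - s := sub_pos.2 hsr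
  set f : ℕ → Ω → ℝ → ENNReal := fun N ω θ =>
    ENNReal.ofReal (‖∑ n ∈ Finset.range N, a n * X n ω * circleMap 0 r θ ^ n‖ ^ p) with hf
  have hfm : ∀ N, Measurable (Function.uncurry (f N)) := by
    intro N
    have h1 : ∀ n, Measurable fun q : Ω × ℝ => X n q.1 := fun n => (hX_meas n).comp measurable_fst
    have h2 : Measurable fun q : Ω × ℝ => circleMap 0 r q.2 :=
      (continuous_circleMap 0 r).measurable.comp measurable_snd
    simp only [hf, Function.uncurry_def]
    fun_prop
  set Q : Ω → ENNReal := fun ω =>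
    liminf (fun N => ∫⁻ θ in Set.Ioc 0 (2 * Real.pi), f N ω θ) atTop with hQ
  have hgm : ∀ N, Measurable fun ω => ∫⁻ θ in Set.Ioc 0 (2 * Real.pi), f N ω θ := fun N =>
    (hfm N).lintegral_prod_right
  have hQm : Measurable Q := Measurable.liminf hgm
  set M : ℝ := (Real.sqrt p * S) ^ p with hM
  have hM0 : 0 < M := by positivity
  have hQle : ∫⁻ ω, Q ω ∂P ≤ ENNReal.ofReal (2 * Real.pi * (2 * Real.exp (2 * c * p) * M)) := by
    refine (lintegral_liminf_le hgm).trans ?_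
    -- The bound on the expectations is uniform in `N`, so a single `N` suffices.
    refine liminf_le_of_le (by isBoundedDefault) fun b hb => ?_
    obtain ⟨N, hN⟩ := hb.exists
    refine hN.trans ?_
    rw [lintegral_lintegral_swap (hfm N).aemeasurable]
    calc _ ≤ ∫⁻ θ in Set.Ioc 0 (2 * Real.pi), ENNReal.ofReal (2 * Real.exp (2 * c * p) * M) := by
          refine lintegral_mono fun θ => ?_
          have := lintegral_norm_sum_pow_le hX_indep hX
            (fun n => a n * circleMap 0 r θ ^ n) N hS (by
              refine le_trans (le_of_eq ?_) (ha N)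
              refine Finset.sum_congr rfl fun n _ => ?_
              rw [norm_mul, norm_pow, norm_circleMap_zero, abs_of_pos hr, mul_pow, ← pow_mul,
                mul_comm 2 n]) hp
          simpa only [hf, mul_right_comm] using this
      _ = _ := by
          rw [setLIntegral_const, Real.volume_Ioc, ← ENNReal.ofReal_mul (by positivity)]
          congr 1; ring
  -- Markov threshold: the `+ 1` in the exponent yields the factor `exp (-p)`, and `(r - s) / r` is
  -- the loss in Cauchy's formula.
  set B : ℝ := (Real.exp (2 * c + 1)) ^ p * M * (2 * Real.pi * (r - s) / r) with hB
  have hB0 : 0 < B := by positivity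
  refine ⟨{ω | ENNReal.ofReal B ≤ Q ω}, ?_, fun ω hω hsum z hz => ?_⟩
  · have h1 := mul_meas_ge_le_lintegral (μ := P) hQm (ENNReal.ofReal B)
    have h2 := h1.trans hQle
    rw [mul_comm, ← ENNReal.le_div_iff_mul_le
      (Or.inl (by simpa using hB0)) (Or.inl ENNReal.ofReal_ne_top),
      ← ENNReal.ofReal_div_of_pos hB0] at h2
    refine h2.trans (le_of_eq ?_)
    congr 1
    rw [hB, ← Real.exp_nat_mul, show (p : ℝ) * (2 * c + 1) = 2 * c * p + p by ring, Real.exp_add,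
      Real.exp_neg]
    field_simp
  · have hlt : Q ω < ENNReal.ofReal B := not_le.1 hω
    have h1 := (norm_tsum_pow_mul_le_liminf p hsr hsum hz).trans_lt hlt
    rw [ENNReal.ofReal_lt_ofReal_iff hB0, hB, hM] at h1
    have h2 := lt_of_mul_lt_mul_right h1 (by positivity)
    rw [← mul_pow] at h2
    exact (lt_of_pow_lt_pow_left₀ p (by positivity) h2).le

/-- Almost surely, multiplying by an `L¹`-bounded sequence keeps the radius of convergence. -/
theorem ae_summable {P : Measure Ω} [IsProbabilityMeasure P] {X : ℕ → Ω → ℂ} {c : ℝ}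
    (hX : ∀ n, Integrable (X n) P ∧ ∫ ω, ‖X n ω‖ ∂P ≤ c)
    {R : EReal} {a : ℕ → ℂ}
    (ha : ∀ r : ℝ, 0 ≤ r → (r : EReal) < R → Summable fun n => ‖a n‖ * r ^ n) :
    ∀ᵐ ω ∂P, ∀ r : ℝ, 0 ≤ r → (r : EReal) < R → Summable fun n => ‖a n * X n ω‖ * r ^ n := by
  have hfix : ∀ r : ℝ, 0 ≤ r → (r : EReal) < R →
      ∀ᵐ ω ∂P, Summable fun n => ‖a n * X n ω‖ * r ^ n := by
    intro r hr hrR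
    have hfin : ∫⁻ ω, ∑' n, ENNReal.ofReal (‖a n * X n ω‖ * r ^ n) ∂P ≠ ⊤ := by
      rw [lintegral_tsum fun n => by
        have := (hX n).1.aestronglyMeasurable.aemeasurable; fun_prop]
      have hle : ∀ n, ∫⁻ ω, ENNReal.ofReal (‖a n * X n ω‖ * r ^ n) ∂P ≤
          ENNReal.ofReal (‖a n‖ * r ^ n * c) := by
        intro n
        have e : ∀ ω, ‖a n * X n ω‖ * r ^ n = ‖a n‖ * r ^ n * ‖X n ω‖ := fun ω => by
          rw [norm_mul]; ring
        simp only [e]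
        rw [← ofReal_integral_eq_lintegral_ofReal ((hX n).1.norm.const_mul _)
          (Eventually.of_forall fun ω => by positivity), integral_const_mul]
        exact ENNReal.ofReal_le_ofReal (mul_le_mul_of_nonneg_left (hX n).2 (by positivity))
      exact ne_top_of_le_ne_top ((ha r hr hrR).mul_right c).tsum_ofReal_ne_top
        (ENNReal.tsum_le_tsum hle)
    filter_upwards [ae_lt_top' (AEMeasurable.tsum fun n => by
        have := (hX n).1.aestronglyMeasurable.aemeasurable; fun_prop) hfin] with ω hω
    have := ENNReal.summable_toReal hω.ne
    refine this.congr fun n => ?_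
    rw [ENNReal.toReal_ofReal (by positivity)]
  -- Rational radii give one null set for all radii, since summability passes to smaller radii.
  have hq : ∀ᵐ ω ∂P, ∀ q : ℚ, 0 ≤ (q : ℝ) → ((q : ℝ) : EReal) < R →
      Summable fun n => ‖a n * X n ω‖ * (q : ℝ) ^ n := by
    rw [ae_all_iff]
    intro q
    by_cases h : 0 ≤ (q : ℝ) ∧ ((q : ℝ) : EReal) < R
    · filter_upwards [hfix q h.1 h.2] with ω hω _ _ using hω
    · exact Eventually.of_forall fun ω h1 h2 => absurd ⟨h1, h2⟩ h
  filter_upwards [hq] with ω hω r hr hrR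
  obtain ⟨r', hrr', hr'R⟩ := EReal.lt_iff_exists_real_btwn.1 hrR
  obtain ⟨q, hrq, hqr'⟩ := exists_rat_btwn (EReal.coe_lt_coe_iff.1 hrr')
  exact summable_norm_mul_pow_mono
    (hω q (hr.trans hrq.le) ((EReal.coe_lt_coe_iff.2 hqr').trans hr'R)) hr hrq.le

end

/-! ### Index mean and variance, and the maximum term. -/

/-- The moment `∑ n ^ j |a n| ^ 2 r ^ (2 n)`. -/
noncomputable def moment (a : ℕ → ℂ) (j : ℕ) (r : ℝ) : ℝ :=
  ∑' n : ℕ, (n : ℝ) ^ j * (‖a n‖ * r ^ n) ^ 2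

section
variable {a : ℕ → ℂ} {R : EReal}

theorem summable_moment (ha : ∀ r : ℝ, 0 ≤ r → (r : EReal) < R → Summable fun n => ‖a n‖ * r ^ n)
    (j : ℕ) {r : ℝ} (hr : 0 ≤ r) (hrR : (r : EReal) < R) :
    Summable fun n : ℕ => (n : ℝ) ^ j * (‖a n‖ * r ^ n) ^ 2 := by
  obtain ⟨r', hrr', hr'R⟩ := EReal.lt_iff_exists_real_btwn.1 hrR
  have hrr' : r < r' := EReal.coe_lt_coe_iff.1 hrr'
  have hr'0 : 0 < r' := hr.trans_lt hrr'
  obtain ⟨M, hM⟩ := (ha r' hr'0.le hr'R).tendsto_atTop_zero.bddAbove_range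
  have hM : ∀ n, ‖a n‖ * r' ^ n ≤ M := fun n => hM ⟨n, rfl⟩
  have hq : ‖(r / r') ^ 2‖ < 1 := by
    rw [Real.norm_eq_abs, abs_of_nonneg (by positivity)]
    exact pow_lt_one₀ (by positivity) ((div_lt_one hr'0).2 hrr') two_ne_zero
  refine ((summable_pow_mul_geometric_of_norm_lt_one j hq).mul_left (M ^ 2)).of_nonneg_of_le
    (fun n => by positivity) fun n => ?_
  have e : ‖a n‖ * r ^ n = (‖a n‖ * r' ^ n) * (r / r') ^ n := by
    rw [div_pow]; field_simp
  rw [e, mul_pow, ← pow_mul, mul_comm n 2, pow_mul]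
  have h1 : (‖a n‖ * r' ^ n) ^ 2 ≤ M ^ 2 := pow_le_pow_left₀ (by positivity) (hM n) 2
  calc _ = (‖a n‖ * r' ^ n) ^ 2 * ((n : ℝ) ^ j * ((r / r') ^ 2) ^ n) := by ring
    _ ≤ _ := by gcongr

/-- Termwise, `r d/dr` multiplies the `n`-th summand by `2n`, hence raises `j` by one. -/
theorem hasDerivAt_moment
    (ha : ∀ r : ℝ, 0 ≤ r → (r : EReal) < R → Summable fun n => ‖a n‖ * r ^ n)
    (j : ℕ) {r : ℝ} (hr : 0 < r) (hrR : (r : EReal) < R) :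
    HasDerivAt (moment a j) (2 / r * moment a (j + 1) r) r := by
  obtain ⟨r', hrr', hr'R⟩ := EReal.lt_iff_exists_real_btwn.1 hrR
  have hrr' : r < r' := EReal.coe_lt_coe_iff.1 hrr'
  -- The left end `r / 2` bounds `2 / x` by `4 / r`, the right end `r'` dominates the powers.
  have hmem : r ∈ Set.Ioo (r / 2) r' := ⟨by linarith, hrr'⟩
  have key := hasDerivAt_tsum_of_isPreconnected
    (g := fun (n : ℕ) (x : ℝ) => (n : ℝ) ^ j * (‖a n‖ * x ^ n) ^ 2)
    (g' := fun (n : ℕ) (x : ℝ) => 2 / x * ((n : ℝ) ^ (j + 1) * (‖a n‖ * x ^ n) ^ 2))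
    (u := fun (n : ℕ) => 4 / r * ((n : ℝ) ^ (j + 1) * (‖a n‖ * r' ^ n) ^ 2))
    (((summable_moment ha (j + 1) (hr.trans hrr').le hr'R)).mul_left (4 / r))
    (isOpen_Ioo (a := r / 2) (b := r')) isPreconnected_Ioo
    (fun n y hy => ?_) (fun n y hy => ?_) hmem (summable_moment ha j hr.le hrR) hmem
  · rw [tsum_mul_left] at key
    exact key
  · have hy0 : 0 < y := (by positivity : (0:ℝ) < r / 2).trans hy.1
    have h := ((((hasDerivAt_pow n y).const_mul ‖a n‖).pow 2).const_mul ((n : ℝ) ^ j))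
    convert! h using 1
    rcases n with _ | n
    · simp
    · simp only [Nat.add_sub_cancel, Nat.cast_add, Nat.cast_one]
      field_simp
      ring
  · have hy0 : 0 < y := (by positivity : (0:ℝ) < r / 2).trans hy.1
    rw [Real.norm_eq_abs, abs_of_nonneg (by positivity)]
    have h1 : 2 / y ≤ 4 / r := by
      rw [div_le_div_iff₀ hy0 hr]; linarith [hy.1]
    have := hy.2.le
    gcongr

theorem bddAbove_terms {r : ℝ} (hs : Summable fun n => ‖a n‖ * r ^ n) :
    BddAbove (Set.range fun n => ‖a n‖ * r ^ n) := hs.tendsto_atTop_zero.bddAbove_range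

theorem term_le_maxTerm {r : ℝ} (hs : Summable fun n => ‖a n‖ * r ^ n) (n : ℕ) :
    ‖a n‖ * r ^ n ≤ maxTerm a r := le_ciSup (bddAbove_terms hs) n

theorem maxTerm_mono {r s : ℝ} (hs : Summable fun n => ‖a n‖ * s ^ n) (hr : 0 ≤ r) (hrs : r ≤ s) :
    maxTerm a r ≤ maxTerm a s :=
  ciSup_mono (bddAbove_terms hs) fun n => by gcongr

theorem moment_zero_mono {r s : ℝ}
    (ha : ∀ r : ℝ, 0 ≤ r → (r : EReal) < R → Summable fun n => ‖a n‖ * r ^ n)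
    (hsR : (s : EReal) < R) (hr : 0 ≤ r) (hrs : r ≤ s) :
    moment a 0 r ≤ moment a 0 s := by
  have hrR : (r : EReal) < R := (EReal.coe_le_coe_iff.2 hrs).trans_lt hsR
  exact (summable_moment ha 0 hr hrR).tsum_le_tsum (fun n => by gcongr)
    (summable_moment ha 0 (hr.trans hrs) hsR)

theorem maxTerm_sq_le_moment
    (ha : ∀ r : ℝ, 0 ≤ r → (r : EReal) < R → Summable fun n => ‖a n‖ * r ^ n)
    {r : ℝ} (hr : 0 ≤ r) (hrR : (r : EReal) < R) :
    maxTerm a r ^ 2 ≤ moment a 0 r := by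
  have hs := summable_moment ha 0 hr hrR
  have h1 : ∀ n, ‖a n‖ * r ^ n ≤ Real.sqrt (moment a 0 r) := fun n => by
    apply Real.le_sqrt_of_sq_le
    have := hs.le_tsum n (fun m _ => by positivity)
    simpa [moment] using this
  have h0 : 0 ≤ moment a 0 r := tsum_nonneg fun n => by positivity
  have h2 : 0 ≤ maxTerm a r := Real.iSup_nonneg fun n => by positivity
  calc maxTerm a r ^ 2 ≤ Real.sqrt (moment a 0 r) ^ 2 := by gcongr; exact ciSup_le h1
    _ = _ := Real.sq_sqrt h0

/-- The variance of the index under the weights `|a n| ^ 2 r ^ (2 n)`. -/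
noncomputable def indexVariance (a : ℕ → ℂ) (r : ℝ) : ℝ :=
  moment a 2 r / moment a 0 r - (moment a 1 r / moment a 0 r) ^ 2

theorem hasSum_sub_sq_mul
    (ha : ∀ r : ℝ, 0 ≤ r → (r : EReal) < R → Summable fun n => ‖a n‖ * r ^ n)
    {r : ℝ} (hr : 0 ≤ r) (hrR : (r : EReal) < R) (hG : 0 < moment a 0 r) :
    HasSum (fun n : ℕ => ((n : ℝ) - moment a 1 r / moment a 0 r) ^ 2 * (‖a n‖ * r ^ n) ^ 2)
      (indexVariance a r * moment a 0 r) := by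
  have h0 := (summable_moment ha 0 hr hrR).hasSum
  have h1 := (summable_moment ha 1 hr hrR).hasSum
  have h2 := (summable_moment ha 2 hr hrR).hasSum
  set m := moment a 1 r / moment a 0 r with hm
  have h := (h2.sub (h1.mul_left (2 * m))).add (h0.mul_left (m ^ 2))
  change HasSum _ (moment a 2 r - 2 * m * moment a 1 r + m ^ 2 * moment a 0 r) at h
  have e1 : moment a 1 r = m * moment a 0 r := by rw [hm]; field_simp
  convert! h using 1
  · funext n; ring
  · rw [indexVariance, ← hm, e1]; field_simp; ring

theorem indexVariance_nonneg
    (ha : ∀ r : ℝ, 0 ≤ r → (r : EReal) < R → Summable fun n => ‖a n‖ * r ^ n)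
    {r : ℝ} (hr : 0 ≤ r) (hrR : (r : EReal) < R) (hG : 0 < moment a 0 r) :
    0 ≤ indexVariance a r := by
  have := (hasSum_sub_sq_mul ha hr hrR hG).nonneg (fun n => by positivity)
  exact nonneg_of_mul_nonneg_left this hG

theorem card_le_of_abs_sub_le (s : Finset ℕ) (m W : ℝ) (hW : 0 ≤ W)
    (hs : ∀ n ∈ s, |(n : ℝ) - m| ≤ W) : (s.card : ℝ) ≤ 2 * W + 1 := by
  rcases s.eq_empty_or_nonempty with rfl | hne
  · simp; linarith
  have hsub : s ⊆ Finset.Icc (s.min' hne) (s.max' hne) := fun n hn =>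
    Finset.mem_Icc.2 ⟨s.min'_le n hn, s.le_max' n hn⟩
  have hcard := Finset.card_le_card hsub
  rw [Nat.card_Icc] at hcard
  have hle : s.min' hne ≤ s.max' hne := s.min'_le _ (s.max'_mem hne)
  have h1 := abs_le.1 (hs _ (s.min'_mem hne))
  have h2 := abs_le.1 (hs _ (s.max'_mem hne))
  have h3 : (s.card : ℝ) ≤ (s.max' hne : ℝ) + 1 - s.min' hne := by
    rw [← Nat.cast_add_one, ← Nat.cast_sub (by omega)]
    exact_mod_cast hcard
  linarith

/-- Chebyshev's inequality: the sum of the squares is concentrated on few indices. -/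
theorem moment_le_variance_mul_maxTerm_sq
    (ha : ∀ r : ℝ, 0 ≤ r → (r : EReal) < R → Summable fun n => ‖a n‖ * r ^ n)
    {r : ℝ} (hr : 0 ≤ r) (hrR : (r : EReal) < R) (hG : 0 < moment a 0 r) :
    moment a 0 r ≤ (6 * Real.sqrt (indexVariance a r) + 4) * maxTerm a r ^ 2 := by
  set m := moment a 1 r / moment a 0 r with hm
  set V := indexVariance a r with hV
  have hV0 : 0 ≤ V := indexVariance_nonneg ha hr hrR hG
  -- `W² ≥ 4V` leaves at most a quarter of the mass outside the window; the `+ 1` keeps `W` positive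
  -- when `V = 0`.
  set W := 2 * Real.sqrt V + 1 with hW
  have hW0 : 0 < W := by positivity
  have h0 : HasSum (fun n : ℕ => (‖a n‖ * r ^ n) ^ 2) (moment a 0 r) := by
    simpa [moment] using (summable_moment ha 0 hr hrR).hasSum
  have h2 := hasSum_sub_sq_mul ha hr hrR hG
  rw [← hm, ← hV] at h2
  have hμ := fun n => term_le_maxTerm (ha r hr hrR) n
  have hμ0 : 0 ≤ maxTerm a r := Real.iSup_nonneg fun n => by positivity
  -- Each term carries the factor `1 - (n - m)² / W²`, which is nonpositive outside the window, so
  -- only the at most `2W + 1` indices inside it count.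
  have hfin : moment a 0 r - V * moment a 0 r / W ^ 2 ≤ (2 * W + 1) * maxTerm a r ^ 2 := by
    refine hasSum_le_of_sum_le (h0.sub (h2.div_const (W ^ 2))) fun s => ?_
    calc _ ≤ ∑ n ∈ s, if |(n : ℝ) - m| ≤ W then maxTerm a r ^ 2 else 0 := by
          refine Finset.sum_le_sum fun n _ => ?_
          have e : (‖a n‖ * r ^ n) ^ 2 - ((n : ℝ) - m) ^ 2 * (‖a n‖ * r ^ n) ^ 2 / W ^ 2 =
            (1 - ((n : ℝ) - m) ^ 2 / W ^ 2) * (‖a n‖ * r ^ n) ^ 2 := by ring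
          rw [e]
          split_ifs with hn
          · calc _ ≤ 1 * (‖a n‖ * r ^ n) ^ 2 := by
                  gcongr
                  have : 0 ≤ ((n : ℝ) - m) ^ 2 / W ^ 2 := by positivity
                  linarith
              _ ≤ _ := by rw [one_mul]; gcongr; exact hμ n
          · refine mul_nonpos_of_nonpos_of_nonneg ?_ (by positivity)
            rw [sub_nonpos, one_le_div (by positivity), sq_le_sq, abs_of_pos hW0]
            exact (not_le.1 hn).le
      _ = ((s.filter fun n : ℕ => |(n : ℝ) - m| ≤ W).card : ℝ) * maxTerm a r ^ 2 := by
          rw [← Finset.sum_filter, Finset.sum_const, nsmul_eq_mul]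
      _ ≤ _ := by
          gcongr
          exact card_le_of_abs_sub_le _ m W hW0.le fun n hn => (Finset.mem_filter.1 hn).2
  have hVW : V * moment a 0 r / W ^ 2 ≤ moment a 0 r / 4 := by
    rw [div_le_div_iff₀ (by positivity) (by norm_num)]
    have : V * 4 ≤ W ^ 2 := by
      have := Real.sq_sqrt hV0
      have := Real.sqrt_nonneg V
      nlinarith
    nlinarith
  have : moment a 0 r ≤ 4 / 3 * ((2 * W + 1) * maxTerm a r ^ 2) := by linarith
  calc _ ≤ _ := this
    _ = (16 / 3 * Real.sqrt V + 4) * maxTerm a r ^ 2 := by rw [hW]; ring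
    _ ≤ _ := by
      have := Real.sqrt_nonneg V
      gcongr
      norm_num

/-- With `hasDerivAt_log_moment` this is the chain from `log G` to mean to variance along which the
growth lemma is applied twice. -/
theorem hasDerivAt_mean
    (ha : ∀ r : ℝ, 0 ≤ r → (r : EReal) < R → Summable fun n => ‖a n‖ * r ^ n)
    {r : ℝ} (hr : 0 < r) (hrR : (r : EReal) < R) (hG : 0 < moment a 0 r) :
    HasDerivAt (fun x => moment a 1 x / moment a 0 x) (2 / r * indexVariance a r) r := by
  convert! (hasDerivAt_moment ha 1 hr hrR).div (hasDerivAt_moment ha 0 hr hrR) hG.ne' using 1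
  rw [indexVariance]; simp only [zero_add, Nat.reduceAdd]; field_simp

theorem hasDerivAt_log_moment
    (ha : ∀ r : ℝ, 0 ≤ r → (r : EReal) < R → Summable fun n => ‖a n‖ * r ^ n)
    {r : ℝ} (hr : 0 < r) (hrR : (r : EReal) < R) (hG : 0 < moment a 0 r) :
    HasDerivAt (fun x => Real.log (moment a 0 x)) (2 / r * (moment a 1 r / moment a 0 r)) r := by
  convert! (hasDerivAt_moment ha 0 hr hrR).log hG.ne' using 1
  simp only [zero_add]; ring

end

/-! ### The growth lemma. -/

section
variable {R : EReal}

/-- The open interval of real numbers `r` with `r₁ < r < R`, where `R` may be `⊤`. -/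
def openIntervalTo (r₁ : ℝ) (R : EReal) : Set ℝ := {r | r₁ < r ∧ (r : EReal) < R}

theorem isOpen_openIntervalTo (r₁ : ℝ) (R : EReal) : IsOpen (openIntervalTo r₁ R) :=
  (isOpen_lt continuous_const continuous_id).inter
    (isOpen_lt continuous_coe_real_ereal continuous_const)

theorem ordConnected_openIntervalTo (r₁ : ℝ) (R : EReal) : (openIntervalTo r₁ R).OrdConnected :=
  ⟨fun _ hx _ hy _ hz => ⟨hx.1.trans_le hz.1, (EReal.coe_le_coe_iff.2 hz.2).trans_lt hy.2⟩⟩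

/-- `u` is monotone, so the integral of its derivative is the length of its image, a bounded set. -/
theorem lintegral_deriv_lt_top {u u' : ℝ → ℝ} {r₁ α β : ℝ}
    (hu : ∀ r ∈ openIntervalTo r₁ R, HasDerivAt u (u' r) r)
    (hu' : ∀ r ∈ openIntervalTo r₁ R, 0 ≤ u' r)
    (hb : ∀ r ∈ openIntervalTo r₁ R, u r ∈ Set.Icc α β) :
    ∫⁻ r in openIntervalTo r₁ R, ENNReal.ofReal (u' r) < ⊤ := by
  have ho := isOpen_openIntervalTo r₁ R
  have hmono : MonotoneOn u (openIntervalTo r₁ R) := by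
    refine monotoneOn_of_deriv_nonneg (ordConnected_openIntervalTo r₁ R).convex
      (fun r hr => (hu r hr).continuousAt.continuousWithinAt)
      (fun r hr => (hu r (interior_subset hr)).differentiableAt.differentiableWithinAt)
      fun r hr => ?_
    rw [(hu r (interior_subset hr)).deriv]
    exact hu' r (interior_subset hr)
  rw [lintegral_deriv_eq_volume_image_of_monotoneOn ho.measurableSet
    (fun r hr => (hu r hr).hasDerivWithinAt) hmono]
  have hsub : u '' openIntervalTo r₁ R ⊆ Set.Icc α β := Set.image_subset_iff.2 hb
  exact (measure_mono hsub).trans_lt measure_Icc_lt_top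

/-- The set where `r F'(r)` exceeds `h(r) F(r) (log F(r)) ^ (1 + ε)`. -/
def growthSet (r₁ : ℝ) (R : EReal) (h F F' : ℝ → ℝ) (ε : ℝ) : Set ℝ :=
  {r ∈ openIntervalTo r₁ R | h r * (F r * Real.log (F r) ^ (1 + ε)) < r * F' r}

theorem isOpen_growthSet {r₁ ε : ℝ} {h F F' : ℝ → ℝ}
    (hh : ContinuousOn h (openIntervalTo r₁ R)) (hF : ContinuousOn F (openIntervalTo r₁ R))
    (hF' : ContinuousOn F' (openIntervalTo r₁ R))
    (hF1 : ∀ r ∈ openIntervalTo r₁ R, Real.exp 1 ≤ F r) :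
    IsOpen (growthSet r₁ R h F F' ε) := by
  have hpos : ∀ r ∈ openIntervalTo r₁ R, 0 < F r := fun r hr => (Real.exp_pos 1).trans_le (hF1 r hr)
  have hlog : ContinuousOn (fun r => Real.log (F r)) (openIntervalTo r₁ R) :=
    hF.log fun r hr => (hpos r hr).ne'
  have hpow : ContinuousOn (fun r => Real.log (F r) ^ (1 + ε)) (openIntervalTo r₁ R) :=
    hlog.rpow_const fun r hr => Or.inl
      (zero_lt_one.trans_le ((Real.le_log_iff_exp_le (hpos r hr)).2 (hF1 r hr))).ne'
  have := ((continuousOn_id.mul hF').sub (hh.mul (hF.mul hpow))).isOpen_inter_preimage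
    (isOpen_openIntervalTo r₁ R) (isOpen_Ioi (a := (0 : ℝ)))
  convert this using 1
  ext r
  simp [growthSet]

/-- The Borel-Nevanlinna growth lemma. -/
theorem hLogMeasure_growthSet_lt_top {ρ r₁ ε : ℝ} (hr₁ : 0 < r₁) (hε : 0 < ε) {h F F' : ℝ → ℝ}
    (hF : ∀ r ∈ openIntervalTo r₁ R, HasDerivAt F (F' r) r)
    (hF'0 : ∀ r ∈ openIntervalTo r₁ R, 0 ≤ F' r)
    (hF1 : ∀ r ∈ openIntervalTo r₁ R, Real.exp 1 ≤ F r)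
    (hopen : IsOpen (growthSet r₁ R h F F' ε)) :
    hLogMeasure ρ R h (growthSet r₁ R h F F' ε) < ⊤ := by
  have hpos : ∀ r ∈ openIntervalTo r₁ R, 0 < F r := fun r hr => (Real.exp_pos 1).trans_le (hF1 r hr)
  have hlog1 : ∀ r ∈ openIntervalTo r₁ R, 1 ≤ Real.log (F r) := fun r hr =>
    (Real.le_log_iff_exp_le (hpos r hr)).2 (hF1 r hr)
  -- An antiderivative of `F' / (F (log F)^(1+ε))`, bounded because `log F ≥ 1`. On the growth set
  -- `h(r) / r` lies below its derivative.
  set u : ℝ → ℝ := fun r => -(Real.log (F r) ^ (-ε)) / ε with hu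
  set u' : ℝ → ℝ := fun r => F' r / (F r * Real.log (F r) ^ (1 + ε)) with hu'
  have hder : ∀ r ∈ openIntervalTo r₁ R, HasDerivAt u (u' r) r := by
    intro r hr
    have hl := hlog1 r hr
    have hl0 : 0 < Real.log (F r) := by linarith
    have h1 := ((((hF r hr).log (hpos r hr).ne').rpow_const (p := -ε)
      (Or.inl hl0.ne')).neg).div_const ε
    convert! h1 using 1
    have hp := hpos r hr
    have e : -ε - 1 = -(1 + ε) := by ring
    rw [hu', e, Real.rpow_neg hl0.le]
    have := Real.rpow_pos_of_pos hl0 (1 + ε)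
    field_simp
  have hfin : ∫⁻ r in openIntervalTo r₁ R, ENNReal.ofReal (u' r) < ⊤ := by
    refine lintegral_deriv_lt_top (α := -1 / ε) (β := 0) hder (fun r hr => ?_) fun r hr => ?_
    · have := hF'0 r hr
      have := hpos r hr
      have := hlog1 r hr
      positivity
    · have h1 : Real.log (F r) ^ (-ε) ≤ 1 :=
        Real.rpow_le_one_of_one_le_of_nonpos (hlog1 r hr) (by linarith)
      have h0 : 0 ≤ Real.log (F r) ^ (-ε) := Real.rpow_nonneg (by linarith [hlog1 r hr]) _
      constructor
      · simp only [hu]; gcongr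
      · simp only [hu]
        exact div_nonpos_of_nonpos_of_nonneg (by linarith) hε.le
  unfold hLogMeasure
  calc _ ≤ ∫⁻ r in growthSet r₁ R h F F' ε, ENNReal.ofReal (h r / r) :=
        lintegral_mono_set Set.inter_subset_left
    _ ≤ ∫⁻ r in growthSet r₁ R h F F' ε, ENNReal.ofReal (u' r) := by
        refine setLIntegral_mono' hopen.measurableSet fun r hr => ?_
        apply ENNReal.ofReal_le_ofReal
        have hr0 : 0 < r := hr₁.trans hr.1.1
        have h1 := hpos r hr.1
        have h2 := hlog1 r hr.1
        have h3 : 0 < Real.log (F r) ^ (1 + ε) := Real.rpow_pos_of_pos (by linarith) _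
        rw [hu', div_le_div_iff₀ hr0 (by positivity)]
        linarith [hr.2]
    _ ≤ ∫⁻ r in openIntervalTo r₁ R, ENNReal.ofReal (u' r) :=
        lintegral_mono_set fun r hr => hr.1
    _ < ⊤ := hfin

/-! ### The grid and the intervals skipped to the left of its points. -/

/-- A continuous monotone unbounded function takes all large integer values. -/
theorem exists_grid {φ : ℝ → ℝ} {r₁ : ℝ} (hc : ContinuousOn φ (openIntervalTo r₁ R))
    (hm : MonotoneOn φ (openIntervalTo r₁ R)) (hne : (openIntervalTo r₁ R).Nonempty)
    (hub : ∀ B : ℝ, ∃ r ∈ openIntervalTo r₁ R, B ≤ φ r) :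
    ∃ (k₀ : ℕ) (q : ℕ → ℝ), 2 ≤ k₀ ∧ (∀ j, q j ∈ openIntervalTo r₁ R) ∧
      (∀ j, φ (q j) = (k₀ + j : ℕ)) ∧
      ∀ J r, q J ≤ r → (r : EReal) < R →
        ∃ j, J ≤ j ∧ r < q j ∧ ((k₀ + j : ℕ) : ℝ) ≤ φ r + 1 := by
  obtain ⟨r₂, hr₂⟩ := hne
  set k₀ : ℕ := max 2 ⌈φ r₂⌉₊ with hk₀
  have hval : ∀ j : ℕ, ∃ r ∈ openIntervalTo r₁ R, φ r = (k₀ + j : ℕ) := by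
    intro j
    obtain ⟨r₃, hr₃, hB⟩ := hub (k₀ + j : ℕ)
    have h1 : φ r₂ ≤ (k₀ + j : ℕ) := by
      refine (Nat.le_ceil _).trans ?_
      exact_mod_cast (le_max_right 2 ⌈φ r₂⌉₊).trans (Nat.le_add_right _ _)
    exact (ordConnected_openIntervalTo r₁ R).isPreconnected.intermediate_value hr₂ hr₃ hc ⟨h1, hB⟩
  choose q hq hφ using hval
  refine ⟨k₀, q, le_max_left _ _, hq, hφ, fun J r hJ hrR => ?_⟩
  have hr : r ∈ openIntervalTo r₁ R := ⟨(hq J).1.trans_le hJ, hrR⟩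
  have h1 : ((k₀ + J : ℕ) : ℝ) ≤ φ r := (hφ J).symm.le.trans (hm (hq J) hr hJ)
  have h0 : 0 ≤ φ r := (Nat.cast_nonneg _).trans h1
  have h2 : k₀ + J ≤ ⌊φ r⌋₊ := Nat.le_floor h1
  obtain ⟨i, hi⟩ := Nat.exists_eq_add_of_le h2
  have e : k₀ + (J + i + 1) = ⌊φ r⌋₊ + 1 := by omega
  -- The grid value `⌊φ r⌋ + 1` is the first integer strictly above `φ r`: it forces `r < q j` and
  -- is at most `φ r + 1`.
  refine ⟨J + i + 1, by omega, ?_, ?_⟩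
  · by_contra hcon
    have h3 := hm (hq _) hr (not_lt.1 hcon)
    rw [hφ, e] at h3
    push_cast at h3
    linarith [Nat.lt_floor_add_one (φ r)]
  · rw [e]
    push_cast
    linarith [Nat.floor_le h0]

/-- The point to the left of `q` at `h`-logarithmic distance about `1 / k ^ 2`. -/
noncomputable def leftPoint (h : ℝ → ℝ) (k : ℕ) (q : ℝ) : ℝ := q - q / ((k : ℝ) ^ 2 * h q)

theorem leftPoint_bounds {h : ℝ → ℝ} {k : ℕ} {q : ℝ} (hk : 2 ≤ k) (hq : 0 < q) (hh : 1 ≤ h q) :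
    q / 2 ≤ leftPoint h k q ∧ leftPoint h k q < q ∧
      q / (q - leftPoint h k q) = (k : ℝ) ^ 2 * h q := by
  have hk' : (2 : ℝ) ≤ k := by exact_mod_cast hk
  have h4 : 2 ≤ (k : ℝ) ^ 2 * h q := by nlinarith
  have h0 : 0 < (k : ℝ) ^ 2 * h q := by linarith
  unfold leftPoint
  refine ⟨?_, ?_, ?_⟩
  · have : q / ((k : ℝ) ^ 2 * h q) ≤ q / 2 := by gcongr
    linarith
  · have : 0 < q / ((k : ℝ) ^ 2 * h q) := by positivity
    linarith
  · rw [sub_sub_cancel]; field_simp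

/-- On the interval to the left of `q`, `h(r) / r ≤ h(q) / s` with `s ≥ q / 2`, and the length is `q
/ (k² h(q))`; so it contributes at most `2 / k²`. -/
theorem hLogMeasure_iUnion_Ioo_lt_top {h : ℝ → ℝ} {ρ r₁ : ℝ} (hr₁ : 0 < r₁) {k₀ : ℕ} (hk₀ : 2 ≤ k₀)
    {q : ℕ → ℝ} (hm : MonotoneOn h (openIntervalTo r₁ R))
    (h1 : ∀ r ∈ openIntervalTo r₁ R, 1 ≤ h r) (hq : ∀ j, q j ∈ openIntervalTo r₁ R) :
    hLogMeasure ρ R h (⋃ j, Set.Ioo (leftPoint h (k₀ + j) (q j)) (q j) ∩ openIntervalTo r₁ R)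
      < ⊤ := by
  unfold hLogMeasure
  have hterm : ∀ j, ∫⁻ r in Set.Ioo (leftPoint h (k₀ + j) (q j)) (q j) ∩ openIntervalTo r₁ R,
      ENNReal.ofReal (h r / r) ≤ ENNReal.ofReal (2 * (1 / ((j + k₀ : ℕ) : ℝ) ^ 2)) := by
    intro j
    have hq0 : 0 < q j := hr₁.trans (hq j).1
    have hh := h1 _ (hq j)
    obtain ⟨b1, b2, b3⟩ := leftPoint_bounds (k := k₀ + j) (by omega) hq0 hh
    set s := leftPoint h (k₀ + j) (q j) with hs
    have hs0 : 0 < s := by linarith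
    calc _ ≤ ∫⁻ r in Set.Ioo s (q j) ∩ openIntervalTo r₁ R, ENNReal.ofReal (h (q j) / s) := by
          refine setLIntegral_mono' (measurableSet_Ioo.inter
            (isOpen_openIntervalTo r₁ R).measurableSet) fun r hr => ?_
          apply ENNReal.ofReal_le_ofReal
          have := hm hr.2 (hq j) hr.1.2.le
          have := hr.1.1.le
          gcongr
      _ ≤ ∫⁻ r in Set.Ioo s (q j), ENNReal.ofReal (h (q j) / s) :=
          lintegral_mono_set Set.inter_subset_left
      _ = ENNReal.ofReal (h (q j) / s * (q j - s)) := by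
          rw [setLIntegral_const, Real.volume_Ioo, ← ENNReal.ofReal_mul (by positivity)]
      _ ≤ _ := by
          apply ENNReal.ofReal_le_ofReal
          have hd : 0 < q j - s := by linarith
          have hk : (0 : ℝ) < ((k₀ + j : ℕ) : ℝ) := by positivity
          rw [add_comm j k₀]
          rw [div_eq_iff hd.ne'] at b3
          have b4 : h (q j) * (q j - s) = q j * (1 / ((k₀ + j : ℕ) : ℝ) ^ 2) := by
            rw [mul_one_div, eq_div_iff (by positivity)]; linarith
          rw [div_mul_eq_mul_div, b4, div_le_iff₀ hs0]
          have : 0 < 1 / ((k₀ + j : ℕ) : ℝ) ^ 2 := by positivity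
          nlinarith
  have hsum : Summable fun j : ℕ => 2 * (1 / ((j + k₀ : ℕ) : ℝ) ^ 2) :=
    ((summable_nat_add_iff (f := fun n : ℕ => 1 / (n : ℝ) ^ 2) k₀).2
      (Real.summable_one_div_nat_pow.2 one_lt_two)).mul_left 2
  calc _ ≤ ∫⁻ r in ⋃ j, Set.Ioo (leftPoint h (k₀ + j) (q j)) (q j) ∩ openIntervalTo r₁ R,
        ENNReal.ofReal (h r / r) := lintegral_mono_set Set.inter_subset_left
    _ ≤ ∑' j, ∫⁻ r in Set.Ioo (leftPoint h (k₀ + j) (q j)) (q j) ∩ openIntervalTo r₁ R,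
        ENNReal.ofReal (h r / r) := lintegral_iUnion_le _ _
    _ ≤ ∑' j : ℕ, ENNReal.ofReal (2 * (1 / ((j + k₀ : ℕ) : ℝ) ^ 2)) := ENNReal.tsum_le_tsum hterm
    _ < ⊤ := hsum.tsum_ofReal_lt_top

end

/-! ### Real inequalities behind the exponents. -/

/-- The growth inequalities for the logarithm of the sum of squares and for its derivative bound
the sum of squares by the maximum term. -/
theorem exists_moment_bound {c c₁ ε : ℝ} (hc₁ : 0 < c₁) (hε : 0 < ε) (hε1 : ε ≤ 1) :
    ∃ D : ℝ, 1 ≤ D ∧ ∀ h m V μ G : ℝ, 0 < G → 1 ≤ h → c₁ ≤ Real.log h →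
      Real.exp 1 ≤ Real.log G + c → 0 ≤ m → 0 ≤ V → 0 < μ →
      2 * m ≤ h * ((Real.log G + c) * Real.log (Real.log G + c) ^ (1 + ε)) →
      2 * V ≤ h * ((m + Real.exp 1) * Real.log (m + Real.exp 1) ^ (1 + ε)) →
      G ≤ (6 * Real.sqrt V + 4) * μ ^ 2 → Real.exp 1 ≤ Real.log (h * μ) →
      Real.log (Real.log G + c) ≤ D * Real.log (Real.log (h * μ)) ∧
      G ≤ D * (h * μ ^ 2 * Real.log (h * μ) ^ (1 / 2 : ℝ) *
        Real.log (Real.log (h * μ)) ^ (1 + ε) * Real.log h ^ ((1 + ε) / 2)) := by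
  set η := 1 + ε with hη
  have hη0 : 0 < η := by linarith
  have hη2 : η ≤ 2 := by linarith
  set D₁ : ℝ := 4 / c₁ + 1 with hD₁
  have hD₁0 : 0 < D₁ := by positivity
  set D₂ : ℝ := 6 * D₁ ^ (η / 2) + 4 * (c₁ ^ (η / 2))⁻¹ with hD₂
  have hD₂0 : 0 < D₂ := by positivity
  set D₃ : ℝ := 4 + |2 * Real.log (64 * D₂) + 2 * c| with hD₃
  have hD₃4 : 4 ≤ D₃ := by rw [hD₃]; linarith [abs_nonneg (2 * Real.log (64 * D₂) + 2 * c)]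
  have hlogD₃ : 0 ≤ Real.log D₃ := Real.log_nonneg (by linarith)
  set D₄ : ℝ := 1 + Real.log D₃ with hD₄
  have hD₄1 : 1 ≤ D₄ := by linarith
  set D₅ : ℝ := D₂ * D₃ ^ (1 / 2 : ℝ) * D₄ ^ η with hD₅
  have hD₅0 : 0 < D₅ := by positivity
  refine ⟨D₃ + D₄ + D₅, by linarith, fun h m V μ G hG h1 hL hy hm hV hμ hm2 hV2 hGV hΛ => ?_⟩
  set y := Real.log G + c with hydef
  set l := Real.log y with hl
  set L := Real.log h with hLdef
  set Λ := Real.log (h * μ) with hΛdef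
  clear_value η D₁ D₂ D₃ D₄ D₅ y l L Λ
  have he : 2 ≤ Real.exp 1 := by linarith [Real.add_one_le_exp 1]
  have hh0 : 0 < h := by linarith
  have hy0 : 0 < y := by linarith
  have hl1 : 1 ≤ l := hl ▸ (Real.le_log_iff_exp_le hy0).2 hy
  have hl0 : 0 < l := by linarith
  have hL0 : 0 < L := by linarith
  have hΛ0 : 0 < Λ := by linarith
  have hℓ1 : 1 ≤ Real.log Λ := (Real.le_log_iff_exp_le hΛ0).2 hΛ
  set ℓ := Real.log Λ with hℓdef
  clear_value ℓ
  have hlη : 1 ≤ l ^ η := Real.one_le_rpow hl1 hη0.le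
  have hlog_le : ∀ x : ℝ, 0 < x → Real.log x ≤ x := fun x hx =>
    (Real.log_le_sub_one_of_pos hx).trans (by linarith)
  -- the mean
  have hmle : m + Real.exp 1 ≤ 2 * (h * (y * l ^ η)) := by
    have h2 : y ≤ h * (y * l ^ η) := by
      calc y = 1 * (y * 1) := by ring
        _ ≤ h * (y * l ^ η) := by gcongr
    linarith
  have hme : 0 < m + Real.exp 1 := by linarith
  have hlogm1 : 1 ≤ Real.log (m + Real.exp 1) := (Real.le_log_iff_exp_le hme).2 (by linarith)
  have hlogm : Real.log (m + Real.exp 1) ≤ D₁ * l * L := by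
    have h2 : Real.log (m + Real.exp 1) ≤ Real.log 2 + (L + (l + η * Real.log l)) := by
      refine (Real.log_le_log hme hmle).trans (le_of_eq ?_)
      rw [Real.log_mul (by positivity) (by positivity), Real.log_mul (by positivity) (by positivity),
        Real.log_mul (by positivity) (by positivity), Real.log_rpow hl0, hLdef, ← hl]
    have h3 : Real.log 2 ≤ 1 := by linarith [Real.log_le_sub_one_of_pos zero_lt_two]
    have h4 : η * Real.log l ≤ 2 * (l - 1) := by
      exact mul_le_mul hη2 (Real.log_le_sub_one_of_pos hl0) (Real.log_nonneg hl1) zero_le_two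
    -- The lower bound `c₁ ≤ L` is what lets constants be absorbed into powers of `L`, which may be
    -- below 1.
    have h5 : 4 * l ≤ 4 / c₁ * l * L := by
      rw [div_mul_eq_mul_div, div_mul_eq_mul_div, le_div_iff₀ hc₁]; gcongr
    have h6 : L ≤ l * L := le_mul_of_one_le_left hL0.le hl1
    rw [hD₁, add_mul, add_mul, one_mul]; linarith
  -- the variance
  have hVle : V ≤ (D₁ ^ (η / 2) * (h * y ^ (1 / 2 : ℝ) * l ^ η * L ^ (η / 2))) ^ 2 := by
    have h2 : Real.log (m + Real.exp 1) ^ η ≤ (D₁ * l * L) ^ η :=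
      Real.rpow_le_rpow (by linarith) hlogm hη0.le
    have h3 : 2 * V ≤ h * (2 * (h * (y * l ^ η)) * (D₁ * l * L) ^ η) := hV2.trans (by gcongr)
    have hsq : ∀ x : ℝ, 0 ≤ x → ∀ t : ℝ, (x ^ (t / 2)) ^ 2 = x ^ t := fun x hx t => by
      rw [← Real.rpow_natCast, ← Real.rpow_mul hx]; congr 1; push_cast; ring
    rw [Real.mul_rpow (by positivity) hL0.le, Real.mul_rpow hD₁0.le hl0.le] at h3
    rw [mul_pow, mul_pow, mul_pow, mul_pow, hsq _ hD₁0.le, hsq _ hL0.le, hsq _ hy0.le,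
      Real.rpow_one]
    linarith
  set Z := h * y ^ (1 / 2 : ℝ) * l ^ η * L ^ (η / 2) with hZ
  have hZ0 : 0 < Z := by positivity
  clear_value Z
  have hVs : Real.sqrt V ≤ D₁ ^ (η / 2) * Z := Real.sqrt_le_iff.2 ⟨by positivity, hVle⟩
  have hZ4 : 4 ≤ 4 * (c₁ ^ (η / 2))⁻¹ * Z := by
    have h2 : c₁ ^ (η / 2) ≤ L ^ (η / 2) := Real.rpow_le_rpow hc₁.le hL (by positivity)
    have h3 : 1 ≤ y ^ (1 / 2 : ℝ) := Real.one_le_rpow (by linarith) (by norm_num)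
    have h4 : c₁ ^ (η / 2) ≤ Z := by
      calc c₁ ^ (η / 2) = 1 * 1 * 1 * c₁ ^ (η / 2) := by ring
        _ ≤ Z := by rw [hZ]; gcongr
    have h5 : 0 < c₁ ^ (η / 2) := by positivity
    rw [mul_assoc, inv_mul_eq_div]
    have : 1 ≤ Z / c₁ ^ (η / 2) := (one_le_div h5).2 h4
    linarith
  have hGZ : G ≤ D₂ * Z * μ ^ 2 := by
    refine hGV.trans ?_
    gcongr
    rw [hD₂]; linarith
  -- the logarithm
  have hy3 : y ≤ D₃ * Λ := by
    have hLh : L ^ (η / 2) ≤ h := by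
      rcases le_total L 1 with h2 | h2
      · exact (Real.rpow_le_one hL0.le h2 (by positivity)).trans h1
      · calc L ^ (η / 2) ≤ L ^ (1 : ℝ) := Real.rpow_le_rpow_of_exponent_le h2 (by linarith)
          _ ≤ h := by rw [Real.rpow_one, hLdef]; exact hlog_le h hh0
    have hly : l ^ η ≤ 4 * y := by
      have h2 : l ^ η ≤ l ^ (2 : ℝ) := Real.rpow_le_rpow_of_exponent_le hl1 hη2
      have h3 : l ≤ 2 * Real.sqrt y := by
        have := hlog_le _ (Real.sqrt_pos.2 hy0)
        rw [Real.log_sqrt hy0.le] at this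
        linarith
      have h4 : l ^ 2 ≤ (2 * Real.sqrt y) ^ 2 := by gcongr
      rw [mul_pow, Real.sq_sqrt hy0.le] at h4
      rw [Real.rpow_two] at h2
      linarith
    have hyh : y ^ (1 / 2 : ℝ) ≤ y := by
      calc y ^ (1 / 2 : ℝ) ≤ y ^ (1 : ℝ) :=
            Real.rpow_le_rpow_of_exponent_le (by linarith) (by norm_num)
        _ = y := Real.rpow_one y
    have hye : y ^ 2 ≤ 16 * Real.exp (y / 2) := by
      have h2 : y / 4 ≤ Real.exp (y / 4) := by linarith [Real.add_one_le_exp (y / 4)]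
      have h3 : Real.exp (y / 2) = Real.exp (y / 4) ^ 2 := by
        rw [← Real.exp_nat_mul]; congr 1; push_cast; ring
      have h4 : (y / 4) ^ 2 ≤ Real.exp (y / 4) ^ 2 := by gcongr
      rw [h3]; linarith
    -- Bootstrap: the bound for `G` still contains `y = log G + c`. Its contribution `y²` is at most
    -- `16 e^(y/2)`, so after taking logarithms half of `y` is absorbed on the left and `y = O(Λ)`
    -- remains.
    have h2 : G ≤ (64 * D₂) * (h * μ) ^ 2 * Real.exp (y / 2) := by
      calc G ≤ D₂ * (h * y * (4 * y) * h) * μ ^ 2 := by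
            refine hGZ.trans ?_
            rw [hZ]; gcongr
        _ = 4 * D₂ * (h * μ) ^ 2 * y ^ 2 := by ring
        _ ≤ 4 * D₂ * (h * μ) ^ 2 * (16 * Real.exp (y / 2)) := by gcongr
        _ = _ := by ring
    have h3 := Real.log_le_log hG h2
    rw [Real.log_mul (by positivity) (by positivity), Real.log_mul (by positivity) (by positivity),
      Real.log_pow, Real.log_exp, ← hΛdef] at h3
    push_cast at h3
    have h4 : y ≤ (2 * Real.log (64 * D₂) + 2 * c) + 4 * Λ := by linarith
    have h5 := le_abs_self (2 * Real.log (64 * D₂) + 2 * c)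
    have h6 := le_mul_of_one_le_right (abs_nonneg (2 * Real.log (64 * D₂) + 2 * c))
      (show 1 ≤ Λ by linarith)
    rw [hD₃, add_mul]; linarith
  have hl4 : l ≤ D₄ * ℓ := by
    have h2 := Real.log_le_log hy0 hy3
    rw [Real.log_mul (by linarith) hΛ0.ne', ← hℓdef] at h2
    rw [hD₄, add_mul, one_mul]; linarith [le_mul_of_one_le_right hlogD₃ hℓ1]
  refine ⟨hl4.trans ?_, hGZ.trans ?_⟩
  · gcongr; linarith
  · calc D₂ * Z * μ ^ 2 ≤
        D₂ * (h * (D₃ * Λ) ^ (1 / 2 : ℝ) * (D₄ * ℓ) ^ η * L ^ (η / 2)) * μ ^ 2 := by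
          rw [hZ]; gcongr
      _ = D₅ * (h * μ ^ 2 * Λ ^ (1 / 2 : ℝ) * ℓ ^ η * L ^ (η / 2)) := by
          rw [Real.mul_rpow (by linarith) hΛ0.le, Real.mul_rpow (by linarith) (by linarith), hD₅]
          ring
      _ ≤ _ := by gcongr; linarith

/-- `Gk`, `hk`, `k` belong to the grid point next to the radius. Since `p` is `O(log h · log log
(hμ))`, the square root of `p G` has `log h` to the power `1/2 + (1 + ε)/4` and `log log (hμ)` to
the power `1/2 + (1 + ε)/2`. -/
theorem exists_modulus_bound {c c₁ D A δ ε : ℝ} (hc₁ : 0 < c₁) (hD : 1 ≤ D) (hA : 0 < A)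
    (hε : 0 < ε) (hεδ : ε ≤ δ) :
    ∃ C : ℝ, 0 < C ∧ ∀ h μ G Gk hk p k M : ℝ, 0 < G → 1 ≤ h → c₁ ≤ Real.log h → 0 < μ →
      Real.exp 1 ≤ Real.log G + c → Real.exp 1 ≤ Real.log (h * μ) →
      Real.log (Real.log G + c) ≤ D * Real.log (Real.log (h * μ)) →
      G ≤ D * (h * μ ^ 2 * Real.log (h * μ) ^ (1 / 2 : ℝ) *
        Real.log (Real.log (h * μ)) ^ (1 + ε) * Real.log h ^ ((1 + ε) / 2)) →
      0 < k → k ≤ Real.log h + Real.log G + 1 → Real.log hk ≤ Real.log h + 1 →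
      0 ≤ p → p ≤ 4 * Real.log k + Real.log hk + 1 → Gk ≤ Real.exp 1 * G →
      M ≤ A * (Real.sqrt p * Real.sqrt Gk) →
      M ≤ C * h ^ (1 / 2 : ℝ) * μ * Real.log h ^ (3 / 4 + δ) * Real.log (h * μ) ^ (1 / 4 : ℝ) *
        Real.log (Real.log (h * μ)) ^ (1 + δ) := by
  set D₇ : ℝ := |c| + 2 with hD₇
  have hD₇2 : 2 ≤ D₇ := by rw [hD₇]; linarith [abs_nonneg c]
  have hlogD₇ : 0 ≤ Real.log D₇ := Real.log_nonneg (by linarith)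
  set D₆ : ℝ := 5 + (4 * Real.log D₇ + 2 + 4 * D) / c₁ with hD₆
  have hD₆0 : 0 < D₆ := by positivity
  set D₈ : ℝ := A * Real.sqrt (D₆ * Real.exp 1 * D) with hD₈
  have hD₈0 : 0 < D₈ := by positivity
  refine ⟨D₈ * (c₁ ^ (δ - ε / 4))⁻¹, by positivity, fun h μ G Gk hk p k M hG h1 hL hμ hy hΛ hl
    hGD hk0 hkle hhk hp0 hp hGk hM => ?_⟩
  set y := Real.log G + c with hydef
  set L := Real.log h with hLdef
  set Λ := Real.log (h * μ) with hΛdef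
  clear_value D₇ D₆ D₈ y L Λ
  have he : 2 ≤ Real.exp 1 := by linarith [Real.add_one_le_exp 1]
  have hh0 : 0 < h := by linarith
  have hy0 : 0 < y := by linarith
  have hL0 : 0 < L := by linarith
  have hΛ0 : 0 < Λ := by linarith
  have hℓ1 : 1 ≤ Real.log Λ := (Real.le_log_iff_exp_le hΛ0).2 hΛ
  set ℓ := Real.log Λ with hℓdef
  clear_value ℓ
  have hlogk : Real.log k ≤ L + Real.log D₇ + Real.log y := by
    have h2 : k ≤ (1 + L) * D₇ * y := by
      have h3 : k ≤ L + y + (|c| + 1) := by linarith [neg_abs_le c]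
      have h4 : L + y + (|c| + 1) ≤ L + D₇ * y := by
        rw [hD₇, add_mul]; linarith [le_mul_of_one_le_right (abs_nonneg c) (show 1 ≤ y by linarith)]
      have h5 : L ≤ L * (D₇ * y) := le_mul_of_one_le_right hL0.le
        (one_le_mul_of_one_le_of_one_le (by linarith) (by linarith))
      linarith
    have h3 := Real.log_le_log hk0 h2
    rw [Real.log_mul (by positivity) (by positivity), Real.log_mul (by positivity) (by positivity)]
      at h3
    have h4 := Real.log_le_sub_one_of_pos (show 0 < 1 + L by linarith)
    linarith
  have hple : p ≤ D₆ * (ℓ * L) := by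
    have h2 : p ≤ 5 * L + (4 * Real.log D₇ + 2 + 4 * D) * ℓ := by
      rw [add_mul, add_mul]; linarith [le_mul_of_one_le_right hlogD₇ hℓ1]
    have h3 : ℓ ≤ ℓ * L / c₁ := by rw [le_div_iff₀ hc₁]; gcongr
    have h4 : (4 * Real.log D₇ + 2 + 4 * D) * ℓ ≤ (4 * Real.log D₇ + 2 + 4 * D) / c₁ * (ℓ * L) := by
      calc _ ≤ (4 * Real.log D₇ + 2 + 4 * D) * (ℓ * L / c₁) := by gcongr
        _ = _ := by ring
    rw [hD₆, add_mul]; linarith [le_mul_of_one_le_left hL0.le hℓ1]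
  set Z := h ^ (1 / 2 : ℝ) * μ * L ^ (3 / 4 + ε / 4) * Λ ^ (1 / 4 : ℝ) * ℓ ^ (1 + ε / 2) with hZ
  have hℓ0 : 0 < ℓ := by linarith
  have hZ0 : 0 < Z := by positivity
  clear_value Z
  have hsq : ∀ x : ℝ, 0 ≤ x → ∀ t : ℝ, (x ^ t) ^ 2 = x ^ (t * 2) := fun x hx t => by
    rw [← Real.rpow_natCast, ← Real.rpow_mul hx]; norm_num
  have hZsq : Z ^ 2 = ℓ * L * (h * μ ^ 2 * Λ ^ (1 / 2 : ℝ) * ℓ ^ (1 + ε) * L ^ ((1 + ε) / 2)) := by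
    have e1 : L ^ ((3 / 4 + ε / 4) * 2) = L * L ^ ((1 + ε) / 2) := by
      rw [← Real.rpow_one_add' hL0.le (by positivity)]; congr 1; ring
    have e2 : ℓ ^ ((1 + ε / 2) * 2) = ℓ * ℓ ^ (1 + ε) := by
      rw [← Real.rpow_one_add' hℓ0.le (by positivity)]; congr 1; ring
    have e3 : (1 / 4 : ℝ) * 2 = 1 / 2 := by norm_num
    have e4 : (1 / 2 : ℝ) * 2 = 1 := by norm_num
    rw [hZ, mul_pow, mul_pow, mul_pow, mul_pow, hsq _ hh0.le, hsq _ hL0.le, hsq _ hΛ0.le,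
      hsq _ hℓ0.le, e1, e2, e3, e4, Real.rpow_one]
    ring
  have hMZ : M ≤ D₈ * Z := by
    refine hM.trans ?_
    rw [← Real.sqrt_mul hp0, hD₈, mul_assoc A]
    refine mul_le_mul_of_nonneg_left ?_ hA.le
    rw [Real.sqrt_le_iff]
    refine ⟨by positivity, ?_⟩
    rw [mul_pow, Real.sq_sqrt (by positivity), hZsq]
    have h2 : Gk ≤ Real.exp 1 * (D * (h * μ ^ 2 * Λ ^ (1 / 2 : ℝ) * ℓ ^ (1 + ε) *
        L ^ ((1 + ε) / 2))) := hGk.trans (by gcongr)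
    calc p * Gk ≤ p * (Real.exp 1 * (D * (h * μ ^ 2 * Λ ^ (1 / 2 : ℝ) * ℓ ^ (1 + ε) *
        L ^ ((1 + ε) / 2)))) := by gcongr
      _ ≤ (D₆ * (ℓ * L)) * (Real.exp 1 * (D * (h * μ ^ 2 * Λ ^ (1 / 2 : ℝ) * ℓ ^ (1 + ε) *
        L ^ ((1 + ε) / 2)))) := by gcongr
      _ = _ := by ring
  -- Raising the exponent costs a constant because `L` may lie in `[c₁, 1)`.
  have hLδ : L ^ (3 / 4 + ε / 4) ≤ (c₁ ^ (δ - ε / 4))⁻¹ * L ^ (3 / 4 + δ) := by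
    have h2 : c₁ ^ (δ - ε / 4) ≤ L ^ (δ - ε / 4) := Real.rpow_le_rpow hc₁.le hL (by linarith)
    have h3 : L ^ (3 / 4 + δ) = L ^ (δ - ε / 4) * L ^ (3 / 4 + ε / 4) := by
      rw [← Real.rpow_add hL0]; congr 1; ring
    rw [inv_mul_eq_div, le_div_iff₀ (by positivity), h3, mul_comm]
    gcongr
  have hℓδ : ℓ ^ (1 + ε / 2) ≤ ℓ ^ (1 + δ) :=
    Real.rpow_le_rpow_of_exponent_le hℓ1 (by linarith)
  calc M ≤ D₈ * Z := hMZ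
    _ ≤ D₈ * (h ^ (1 / 2 : ℝ) * μ * ((c₁ ^ (δ - ε / 4))⁻¹ * L ^ (3 / 4 + δ)) * Λ ^ (1 / 4 : ℝ) *
        ℓ ^ (1 + δ)) := by rw [hZ]; gcongr
    _ = _ := by ring

/-! ### Assembling the deterministic and the probabilistic part. -/

section
variable {R : EReal} {a : ℕ → ℂ}

theorem IsPowerSeriesOn.summable_norm {f : ℂ → ℂ} (hf : IsPowerSeriesOn R a f) {r : ℝ}
    (hr : 0 ≤ r) (hrR : (r : EReal) < R) : Summable fun n => ‖a n‖ * r ^ n := by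
  have hn : ‖(r : ℂ)‖ = r := by rw [Complex.norm_real, Real.norm_eq_abs, abs_of_nonneg hr]
  have h := (hf.2 (r : ℂ) (by simpa only [disc, Set.mem_ofPred_eq, hn] using hrR)).summable.norm
  simpa only [norm_mul, norm_pow, hn] using h

theorem isPowerSeriesOn_tsum
    (ha : ∀ r : ℝ, 0 ≤ r → (r : EReal) < R → Summable fun n => ‖a n‖ * r ^ n) :
    IsPowerSeriesOn R a (fun z => ∑' n, a n * z ^ n) := by
  have hopen : IsOpen (disc R) :=
    isOpen_lt (continuous_coe_real_ereal.comp continuous_norm) continuous_const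
  refine ⟨DifferentiableOn.analyticOnNhd (fun z hz => ?_) hopen, fun z hz => ?_⟩
  · obtain ⟨r, hzr, hrR⟩ := EReal.lt_iff_exists_real_btwn.1 (show ((‖z‖ : ℝ) : EReal) < R from hz)
    have hzr : ‖z‖ < r := EReal.coe_lt_coe_iff.1 hzr
    have h := Complex.differentiableOn_tsum_of_summable_norm (U := Metric.ball (0 : ℂ) r)
      (F := fun n z => a n * z ^ n) (ha r ((norm_nonneg z).trans hzr.le) hrR)
      (fun n => by fun_prop) Metric.isOpen_ball (fun n w hw => by
        have : ‖w‖ ≤ r := by simpa using (Metric.mem_ball.1 hw).le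
        rw [norm_mul, norm_pow]
        gcongr)
    exact (h.differentiableAt (Metric.isOpen_ball.mem_nhds (by simpa using hzr))).differentiableWithinAt
  · refine (Summable.of_norm ?_).hasSum
    simpa only [norm_mul, norm_pow] using ha ‖z‖ (norm_nonneg z) hz

theorem IsPowerSeriesOn.exists_ne_zero {f : ℂ → ℂ} (hf : IsPowerSeriesOn R a f)
    (hc : ¬ ∃ c : ℂ, ∀ z ∈ disc R, f z = c) : ∃ n, 1 ≤ n ∧ a n ≠ 0 := by
  by_contra! hcon
  refine hc ⟨a 0, fun z hz => (hf.2 z hz).unique ?_⟩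
  convert hasSum_single (f := fun n => a n * z ^ n) 0 fun n hn => ?_ using 1
  · simp
  · simp [hcon n (Nat.one_le_iff_ne_zero.2 hn)]

/-- Applied to `h` with `c = 1`, the gap `c₀ > 1` keeps `log h` away from 0 near `R`. -/
theorem LimGT.exists_le {ρ c : ℝ} {u : ℝ → ℝ} (hu : LimGT R u c) (hρ : (ρ : EReal) < R) :
    ∃ c₀ r₁ : ℝ, c < c₀ ∧ ρ < r₁ ∧ (r₁ : EReal) < R ∧ ∀ r ∈ intervalTo r₁ R, c₀ ≤ u r := by
  obtain ⟨L, hL, hlim⟩ := hu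
  obtain ⟨c₀, hc₀, hc₀L⟩ := EReal.lt_iff_exists_real_btwn.1 hL
  have hev := hlim.eventually (lt_mem_nhds hc₀L)
  obtain ⟨t, ht, hsub⟩ := mem_comap.1 hev
  obtain ⟨l, hl, hlt⟩ := (mem_nhdsLT_iff_exists_mem_Ico_Ioo_subset hρ).1 ht
  obtain ⟨r₁, hlr₁, hr₁R⟩ := EReal.lt_iff_exists_real_btwn.1 hl.2
  refine ⟨c₀, r₁, EReal.coe_lt_coe_iff.1 hc₀, EReal.coe_lt_coe_iff.1 (hl.1.trans_lt hlr₁), hr₁R,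
    fun r hr => ?_⟩
  have : (c₀ : EReal) < u r :=
    hsub (hlt ⟨hlr₁.trans_le (EReal.coe_le_coe_iff.2 hr.1), hr.2⟩)
  exact (EReal.coe_lt_coe_iff.1 this).le

theorem moment_zero_pos
    (ha : ∀ r : ℝ, 0 ≤ r → (r : EReal) < R → Summable fun n => ‖a n‖ * r ^ n)
    (hne : ∃ n, 1 ≤ n ∧ a n ≠ 0) {r : ℝ} (hr : 0 < r) (hrR : (r : EReal) < R) :
    0 < moment a 0 r := by
  obtain ⟨n, -, hn⟩ := hne
  have hn' := norm_pos_iff.2 hn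
  exact (summable_moment ha 0 hr.le hrR).tsum_pos (fun m => by positivity) n (by positivity)

theorem maxTerm_pos
    (ha : ∀ r : ℝ, 0 ≤ r → (r : EReal) < R → Summable fun n => ‖a n‖ * r ^ n)
    (hne : ∃ n, 1 ≤ n ∧ a n ≠ 0) {r : ℝ} (hr : 0 < r) (hrR : (r : EReal) < R) :
    0 < maxTerm a r := by
  obtain ⟨n, -, hn⟩ := hne
  have hn' := norm_pos_iff.2 hn
  exact (by positivity : 0 < ‖a n‖ * r ^ n).trans_le (term_le_maxTerm (ha r hr.le hrR) n)

/-- If the `h`-logarithmic measure of every neighbourhood of `R` is infinite, then `h(r) μ(r)`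
tends to infinity. -/
theorem exists_le_mul_maxTerm
    (ha : ∀ r : ℝ, 0 ≤ r → (r : EReal) < R → Summable fun n => ‖a n‖ * r ^ n)
    (hne : ∃ n, 1 ≤ n ∧ a n ≠ 0) {r₁ : ℝ} (hr₁ : 0 < r₁) (hr₁R : (r₁ : EReal) < R) {h : ℝ → ℝ}
    (h1 : ∀ r ∈ openIntervalTo r₁ R, 1 ≤ h r) (hm : MonotoneOn h (openIntervalTo r₁ R))
    (hdiv : ∫⁻ r in openIntervalTo r₁ R, ENNReal.ofReal (h r / r) = ⊤) (B : ℝ) :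
    ∃ r₂ ∈ openIntervalTo r₁ R, ∀ r ∈ intervalTo r₂ R, B ≤ h r * maxTerm a r := by
  have hopen : ∀ {r₂}, r₂ ∈ openIntervalTo r₁ R → ∀ r ∈ intervalTo r₂ R, r ∈ openIntervalTo r₁ R :=
    fun hr₂ r hr => ⟨hr₂.1.trans_le hr.1, hr.2⟩
  -- For `R = ⊤` a nonzero coefficient of positive index makes `maxTerm` unbounded. For finite `R`
  -- it is `h` that is unbounded, since a bounded integrand on a bounded interval away from 0 would
  -- have finite integral.
  by_cases hR : R = ⊤
  · obtain ⟨n, hn1, hn⟩ := hne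
    have hn' := norm_pos_iff.2 hn
    have hr₂ : max (r₁ + 1) (max 1 (B / ‖a n‖)) ∈ openIntervalTo r₁ R :=
      ⟨(lt_add_one r₁).trans_le (le_max_left _ _), hR ▸ EReal.coe_lt_top _⟩
    refine ⟨_, hr₂, fun r hr => ?_⟩
    have hr1 : 1 ≤ r := (le_max_left _ _).trans ((le_max_right _ _).trans hr.1)
    have hrB : B / ‖a n‖ ≤ r := (le_max_right _ _).trans ((le_max_right _ _).trans hr.1)
    have hμ := term_le_maxTerm (ha r (by linarith) hr.2) n
    have hμ0 : 0 ≤ maxTerm a r := le_trans (by positivity) hμ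
    calc B ≤ ‖a n‖ * r := by rw [div_le_iff₀ hn'] at hrB; linarith
      _ ≤ ‖a n‖ * r ^ n := by gcongr; exact le_self_pow₀ hr1 (by omega)
      _ ≤ maxTerm a r := hμ
      _ ≤ h r * maxTerm a r := le_mul_of_one_le_left hμ0 (h1 r (hopen hr₂ r hr))
  · have hμ₁ := maxTerm_pos ha hne hr₁ hr₁R
    have hub : ∃ r₂ ∈ openIntervalTo r₁ R, |B| / maxTerm a r₁ ≤ h r₂ := by
      by_contra! hcon
      lift R to ℝ using ⟨hR, (bot_le.trans_lt hr₁R).ne'⟩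
      have hsub : openIntervalTo r₁ (R : EReal) ⊆ Set.Ioo r₁ R := fun r hr =>
        ⟨hr.1, EReal.coe_lt_coe_iff.1 hr.2⟩
      refine hdiv.not_lt ?_
      calc _ ≤ ∫⁻ r in openIntervalTo r₁ (R : EReal),
            ENNReal.ofReal (|B| / maxTerm a r₁ / r₁) := by
            refine setLIntegral_mono' (isOpen_openIntervalTo _ _).measurableSet fun r hr => ?_
            apply ENNReal.ofReal_le_ofReal
            have := (hcon r hr).le
            have := hr.1.le
            gcongr
        _ ≤ ∫⁻ r in Set.Ioo r₁ R, ENNReal.ofReal (|B| / maxTerm a r₁ / r₁) :=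
            lintegral_mono_set hsub
        _ < ⊤ := by
            rw [setLIntegral_const]
            exact ENNReal.mul_lt_top ENNReal.ofReal_lt_top measure_Ioo_lt_top
    obtain ⟨r₂, hr₂, hB⟩ := hub
    refine ⟨r₂, hr₂, fun r hr => ?_⟩
    have hh := hm hr₂ (hopen hr₂ r hr) hr.1
    have hμ := maxTerm_mono (ha r (by linarith [hr₂.1, hr.1]) hr.2) hr₁.le (hr₂.1.le.trans hr.1)
    have h0 := h1 r₂ hr₂
    calc B ≤ |B| := le_abs_self B
      _ = |B| / maxTerm a r₁ * maxTerm a r₁ := by field_simp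
      _ ≤ h r * maxTerm a r := mul_le_mul (hB.trans hh) hμ hμ₁.le (by linarith)

theorem hLogMeasure_union_lt_top {ρ : ℝ} {h : ℝ → ℝ} {E F : Set ℝ}
    (hE : hLogMeasure ρ R h E < ⊤) (hF : hLogMeasure ρ R h F < ⊤) :
    hLogMeasure ρ R h (E ∪ F) < ⊤ := by
  unfold hLogMeasure at *
  rw [Set.union_inter_distrib_right]
  exact (lintegral_union_le _ _ _).trans_lt (ENNReal.add_lt_top.2 ⟨hE, hF⟩)

theorem maxModulus_le {g : ℂ → ℂ} {r B : ℝ} (hr : 0 ≤ r) (h : ∀ z : ℂ, ‖z‖ = r → ‖g z‖ ≤ B) :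
    maxModulus g r ≤ B := by
  refine csSup_le (((NormedSpace.sphere_nonempty).2 hr).image _) ?_
  rintro _ ⟨z, hz, rfl⟩
  exact h z (by simpa using hz)

/-- The deterministic part: outside of an open set of finite `h`-logarithmic measure the sum of
squares is controlled by the maximum term. -/
theorem exists_exceptional_set
    (ha : ∀ r : ℝ, 0 ≤ r → (r : EReal) < R → Summable fun n => ‖a n‖ * r ^ n)
    (hne : ∃ n, 1 ≤ n ∧ a n ≠ 0) {r₁ c₁ ε : ℝ} (hr₁ : 0 < r₁) (hr₁R : (r₁ : EReal) < R)
    {h : ℝ → ℝ} (hc₁ : 0 < c₁) (hε : 0 < ε) (hε1 : ε ≤ 1)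
    (h1 : ∀ r ∈ openIntervalTo r₁ R, 1 ≤ h r)
    (hlog : ∀ r ∈ openIntervalTo r₁ R, c₁ ≤ Real.log (h r))
    (hc : ContinuousOn h (openIntervalTo r₁ R)) :
    ∃ (E : Set ℝ) (c D : ℝ), IsOpen E ∧ E ⊆ openIntervalTo r₁ R ∧
      (∀ ρ, hLogMeasure ρ R h E < ⊤) ∧ 1 ≤ D ∧
      (∀ r ∈ openIntervalTo r₁ R, Real.exp 1 ≤ Real.log (moment a 0 r) + c) ∧
      ∀ r ∈ openIntervalTo r₁ R, r ∉ E → Real.exp 1 ≤ Real.log (h r * maxTerm a r) →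
        Real.log (Real.log (moment a 0 r) + c) ≤
          D * Real.log (Real.log (h r * maxTerm a r)) ∧
        moment a 0 r ≤ D * (h r * maxTerm a r ^ 2 * Real.log (h r * maxTerm a r) ^ (1 / 2 : ℝ) *
          Real.log (Real.log (h r * maxTerm a r)) ^ (1 + ε) * Real.log (h r) ^ ((1 + ε) / 2)) := by
  -- This shift makes `log G + c ≥ e` on the whole interval, as the growth lemma requires; the mean
  -- is shifted by `e` for the same reason.
  set c := Real.exp 1 - Real.log (moment a 0 r₁) with hcdef
  obtain ⟨D, hD, hbound⟩ := exists_moment_bound (c := c) hc₁ hε hε1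
  have hr0 : ∀ r ∈ openIntervalTo r₁ R, 0 < r := fun r hr => hr₁.trans hr.1
  have hG : ∀ r ∈ openIntervalTo r₁ R, 0 < moment a 0 r := fun r hr =>
    moment_zero_pos ha hne (hr0 r hr) hr.2
  have hd1 : ∀ r ∈ openIntervalTo r₁ R, HasDerivAt (fun x => Real.log (moment a 0 x) + c)
      (2 / r * (moment a 1 r / moment a 0 r)) r := fun r hr =>
    (hasDerivAt_log_moment ha (hr0 r hr) hr.2 (hG r hr)).add_const c
  have hd2 : ∀ r ∈ openIntervalTo r₁ R,
      HasDerivAt (fun x => moment a 1 x / moment a 0 x + Real.exp 1)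
        (2 / r * indexVariance a r) r := fun r hr =>
    (hasDerivAt_mean ha (hr0 r hr) hr.2 (hG r hr)).add_const _
  have hcm : ∀ j, ContinuousOn (moment a j) (openIntervalTo r₁ R) := fun j r hr =>
    (hasDerivAt_moment ha j (hr0 r hr) hr.2).continuousAt.continuousWithinAt
  have hG' : ∀ r ∈ openIntervalTo r₁ R, moment a 0 r ≠ 0 := fun r hr => (hG r hr).ne'
  have hinv : ContinuousOn (fun r : ℝ => 2 / r) (openIntervalTo r₁ R) :=
    continuousOn_const.div continuousOn_id fun r hr => (hr0 r hr).ne'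
  have hcmean := (hcm 1).div (hcm 0) hG'
  have hcvar : ContinuousOn (indexVariance a) (openIntervalTo r₁ R) :=
    ((hcm 2).div (hcm 0) hG').sub (hcmean.pow 2)
  have hmean0 : ∀ r ∈ openIntervalTo r₁ R, 0 ≤ moment a 1 r / moment a 0 r := fun r hr =>
    div_nonneg (tsum_nonneg fun n => by have := hr0 r hr; positivity) (hG r hr).le
  have hvar0 : ∀ r ∈ openIntervalTo r₁ R, 0 ≤ indexVariance a r := fun r hr =>
    indexVariance_nonneg ha (hr0 r hr).le hr.2 (hG r hr)
  have hF1 : ∀ r ∈ openIntervalTo r₁ R, Real.exp 1 ≤ Real.log (moment a 0 r) + c := by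
    intro r hr
    have := Real.log_le_log (moment_zero_pos ha hne hr₁ hr₁R)
      (moment_zero_mono ha hr.2 hr₁.le hr.1.le)
    rw [hcdef]; linarith
  have hF2 : ∀ r ∈ openIntervalTo r₁ R,
      Real.exp 1 ≤ moment a 1 r / moment a 0 r + Real.exp 1 := fun r hr => by
    linarith [hmean0 r hr]
  have ho1 := isOpen_growthSet (ε := ε) hc
    (fun r hr => (hd1 r hr).continuousAt.continuousWithinAt) (hinv.mul hcmean) hF1
  have ho2 := isOpen_growthSet (ε := ε) hc
    (fun r hr => (hd2 r hr).continuousAt.continuousWithinAt) (hinv.mul hcvar) hF2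
  refine ⟨_, c, D, ho1.union ho2, Set.union_subset (fun r hr => hr.1) (fun r hr => hr.1),
    fun ρ => hLogMeasure_union_lt_top
      (hLogMeasure_growthSet_lt_top hr₁ hε hd1 (fun r hr => ?_) hF1 ho1)
      (hLogMeasure_growthSet_lt_top hr₁ hε hd2 (fun r hr => ?_) hF2 ho2),
    hD, hF1, fun r hr hrE hΛ => ?_⟩
  · have := hr0 r hr
    exact mul_nonneg (by positivity) (hmean0 r hr)
  · have := hr0 r hr
    exact mul_nonneg (by positivity) (hvar0 r hr)
  · have hr0' := hr0 r hr
    have hn1 := not_lt.1 fun hlt => hrE (Or.inl ⟨hr, hlt⟩)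
    have hn2 := not_lt.1 fun hlt => hrE (Or.inr ⟨hr, hlt⟩)
    have e : ∀ x : ℝ, r * (2 / r * x) = 2 * x := fun x => by field_simp
    simp only [Pi.mul_apply, Pi.div_apply, e] at hn1 hn2
    exact hbound (h r) _ _ (maxTerm a r) _ (hG r hr) (h1 r hr) (hlog r hr) (hF1 r hr)
      (hmean0 r hr) (hvar0 r hr) (maxTerm_pos ha hne hr0' hr.2) hn1 hn2
      (moment_le_variance_mul_maxTerm_sq ha hr0'.le hr.2 (hG r hr)) hΛ

/-- The probabilistic part: along a grid, the random series is almost surely controlled by the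
sum of squares. -/
theorem ae_eventually_norm_tsum_le {Ω : Type*} [MeasurableSpace Ω] {P : Measure Ω}
    [IsProbabilityMeasure P] {X : ℕ → Ω → ℂ}
    (hX_meas : ∀ n, Measurable (X n)) (hX_indep : iIndepFun X P) {c : NNReal}
    (hX : ∀ n (u : ℂ),
        HasSubgaussianMGF (fun ω => (u * X n ω).re) (⟨‖u‖ ^ 2, sq_nonneg _⟩ * c) P)
    (hX_int : ∀ n, Integrable (X n) P ∧ ∫ ω, ‖X n ω‖ ∂P ≤ c)
    (ha : ∀ r : ℝ, 0 ≤ r → (r : EReal) < R → Summable fun n => ‖a n‖ * r ^ n)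
    (hne : ∃ n, 1 ≤ n ∧ a n ≠ 0) {h : ℝ → ℝ} {k₀ : ℕ} (hk₀ : 2 ≤ k₀) {q : ℕ → ℝ}
    (hq : ∀ j, 0 < q j ∧ (q j : EReal) < R ∧ 1 ≤ h (q j)) :
    ∀ᵐ ω ∂P, ∀ᶠ j in atTop, ∀ z : ℂ, ‖z‖ ≤ leftPoint h (k₀ + j) (q j) →
      ‖∑' n, a n * X n ω * z ^ n‖ ≤ Real.exp (2 * c + 1) *
        (Real.sqrt ⌈Real.log (((k₀ + j : ℕ) : ℝ) ^ 4 * h (q j))⌉₊ *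
          Real.sqrt (moment a 0 (q j))) := by
  have hset : ∀ j, ∃ A : Set Ω, P A ≤ ENNReal.ofReal (2 * (1 / ((j + k₀ : ℕ) : ℝ) ^ 2)) ∧
      ∀ ω ∉ A, (Summable fun n => ‖a n * X n ω‖ * q j ^ n) →
        ∀ z : ℂ, ‖z‖ ≤ leftPoint h (k₀ + j) (q j) →
          ‖∑' n, a n * X n ω * z ^ n‖ ≤ Real.exp (2 * c + 1) *
            (Real.sqrt ⌈Real.log (((k₀ + j : ℕ) : ℝ) ^ 4 * h (q j))⌉₊ *
              Real.sqrt (moment a 0 (q j))) := by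
    intro j
    obtain ⟨hq0, hqR, hh⟩ := hq j
    have hG := moment_zero_pos ha hne hq0 hqR
    obtain ⟨b1, b2, b3⟩ := leftPoint_bounds (k := k₀ + j) (by omega) hq0 hh
    set k : ℝ := ((k₀ + j : ℕ) : ℝ) with hk
    have hk2 : 2 ≤ k := by rw [hk]; exact_mod_cast hk₀.trans (Nat.le_add_right _ _)
    have hk1 : 1 < k ^ 4 * h (q j) := by
      have : 1 < k ^ 4 := one_lt_pow₀ (by linarith) (by norm_num)
      nlinarith
    have hlogpos := Real.log_pos hk1
    obtain ⟨A, hA, hA'⟩ := measure_large_le hX_meas hX_indep hX a hq0 b2 (Real.sqrt_pos.2 hG)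
      (fun N => by
        rw [Real.sq_sqrt hG.le]
        refine le_trans (le_of_eq (Finset.sum_congr rfl fun n _ => ?_))
          ((summable_moment ha 0 hq0.le hqR).sum_le_tsum (Finset.range N)
            fun n _ => by positivity)
        ring)
      (p := ⌈Real.log (k ^ 4 * h (q j))⌉₊) (Nat.ceil_pos.2 hlogpos)
    refine ⟨A, hA.trans (ENNReal.ofReal_le_ofReal ?_), hA'⟩
    rw [b3, add_comm j k₀, ← hk]
    -- The choice of `p`: `e^(-p)` beats the Cauchy loss `k² h(q j)` by `k²`, leaving a summable `2
    -- / k²`.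
    have h3 : Real.exp (-(⌈Real.log (k ^ 4 * h (q j))⌉₊ : ℝ)) ≤ (k ^ 4 * h (q j))⁻¹ := by
      rw [← Real.exp_log (show 0 < k ^ 4 * h (q j) by linarith), ← Real.exp_neg]
      apply Real.exp_le_exp.2
      rw [Real.exp_log (by linarith)]
      exact neg_le_neg (Nat.le_ceil _)
    calc _ ≤ 2 * ((k ^ 4 * h (q j))⁻¹ * (k ^ 2 * h (q j))) := by gcongr
      _ = _ := by field_simp
  choose A hA hA' using hset
  have hsum : Summable fun j : ℕ => 2 * (1 / ((j + k₀ : ℕ) : ℝ) ^ 2) :=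
    ((summable_nat_add_iff (f := fun n : ℕ => 1 / (n : ℝ) ^ 2) k₀).2
      (Real.summable_one_div_nat_pow.2 one_lt_two)).mul_left 2
  have hBC := ae_eventually_notMem (μ := P) (s := A)
    (ne_top_of_le_ne_top hsum.tsum_ofReal_ne_top (ENNReal.tsum_le_tsum hA))
  filter_upwards [hBC, ae_summable hX_int ha] with ω hω hs
  filter_upwards [hω] with j hj
  exact hA' j ω hj (hs (q j) (hq j).1.le (hq j).2.1)

end

end RandomPowerSeries

/-! ### The main theorem. -/

open RandomPowerSeries in
theorem theorem5p3
    {Ω : Type*} [MeasurableSpace Ω] (P : Measure Ω) [IsProbabilityMeasure P]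
    (R : EReal) (hR : 0 < R)
    (a : ℕ → ℂ) (f : ℂ → ℂ) (hf : RandomPowerSeries.IsPowerSeriesOn R a f)
    (hf_nonconst : ¬ ∃ c : ℂ, ∀ z ∈ RandomPowerSeries.disc R, f z = c)
    (ρ : ℝ) (hρ : 0 ≤ ρ) (hρR : (ρ : EReal) < R)
    (h : ℝ → ℝ)
    (h_nonneg : ∀ r ∈ RandomPowerSeries.intervalTo ρ R, 0 ≤ h r)
    (h_cont : ContinuousOn h (RandomPowerSeries.intervalTo ρ R))
    (h_mono : MonotoneOn h (RandomPowerSeries.intervalTo ρ R))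
    (h_div : ∫⁻ r in RandomPowerSeries.intervalTo ρ R, ENNReal.ofReal (h r / r) = ⊤)
    (h_lim : RandomPowerSeries.LimGT R h 1)
    (hmu_lim : RandomPowerSeries.LimGT R (fun r => h r * RandomPowerSeries.maxTerm a r) 1)
    (X : ℕ → Ω → ℂ) (hX_meas : ∀ n, Measurable (X n))
    (hX_indep : iIndepFun X P)
    (hX_centred : ∀ n, ∫ ω, X n ω ∂P = 0)
    (hX_subgaussian : RandomPowerSeries.IsSubgaussianSeq P X) :
    (∀ᵐ ω ∂P, ∃ g : ℂ → ℂ, RandomPowerSeries.IsPowerSeriesOn R (fun n => a n * X n ω) g) ∧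
    ∀ δ : ℝ, 0 < δ →
      ∃ E : Set ℝ, IsOpen E ∧ E ⊆ RandomPowerSeries.intervalTo 0 R ∧
        RandomPowerSeries.hLogMeasure ρ R h E < ⊤ ∧
        ∃ C : ℝ, 0 < C ∧
          ∀ᵐ ω ∂P, ∃ r₀ : ℝ, ρ < r₀ ∧ (r₀ : EReal) < R ∧
            ∀ r ∈ RandomPowerSeries.intervalTo r₀ R, r ∉ E →
              RandomPowerSeries.maxModulus (fun z => ∑' n, a n * X n ω * z ^ n) r ≤
                C * h r ^ (1 / 2 : ℝ) * RandomPowerSeries.maxTerm a r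
                  * Real.log (h r) ^ (3 / 4 + δ)
                  * Real.log (h r * RandomPowerSeries.maxTerm a r) ^ (1 / 4 : ℝ)
                  * Real.log (Real.log (h r * RandomPowerSeries.maxTerm a r)) ^ (1 + δ) := by
  have ha : ∀ r : ℝ, 0 ≤ r → (r : EReal) < R → Summable fun n => ‖a n‖ * r ^ n :=
    fun r hr hrR => hf.summable_norm hr hrR
  have hne := hf.exists_ne_zero hf_nonconst
  obtain ⟨c, hX, hX_int⟩ := exists_hasSubgaussianMGF_re hX_meas hX_centred hX_subgaussian
  refine ⟨?_, fun δ hδ => ?_⟩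
  · filter_upwards [ae_summable hX_int ha] with ω hω
    exact ⟨_, isPowerSeriesOn_tsum hω⟩
  obtain ⟨c₀, r₁, hc₀, hρr₁, hr₁R, hc₀h⟩ := h_lim.exists_le hρR
  have hr₁ : 0 < r₁ := hρ.trans_lt hρr₁
  have hsub : openIntervalTo r₁ R ⊆ intervalTo ρ R := fun r hr => ⟨(hρr₁.trans hr.1).le, hr.2⟩
  have hsub0 : openIntervalTo r₁ R ⊆ intervalTo 0 R := fun r hr => ⟨(hr₁.trans hr.1).le, hr.2⟩
  obtain ⟨r₁', hr₁r₁', hr₁'R⟩ := EReal.lt_iff_exists_real_btwn.1 hr₁R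
  have hne₁ : r₁' ∈ openIntervalTo r₁ R := ⟨EReal.coe_lt_coe_iff.1 hr₁r₁', hr₁'R⟩
  -- When `ρ = 0` the integral may diverge only at 0. Then all radii near `R` form an admissible
  -- exceptional set and nothing remains to be bounded.
  by_cases hfin : ∫⁻ r in openIntervalTo r₁ R, ENNReal.ofReal (h r / r) = ⊤
  swap
  · refine ⟨openIntervalTo r₁ R, isOpen_openIntervalTo r₁ R, hsub0,
      (lintegral_mono_set Set.inter_subset_left).trans_lt (lt_top_iff_ne_top.2 hfin), 1, one_pos,
      Eventually.of_forall fun ω => ⟨r₁', hρr₁.trans hne₁.1, hr₁'R, fun r hr hrE => ?_⟩⟩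
    exact absurd ⟨hne₁.1.trans_le hr.1, hr.2⟩ hrE
  have hcont := h_cont.mono hsub
  have hmono := h_mono.mono hsub
  have hc₀h' : ∀ r ∈ openIntervalTo r₁ R, c₀ ≤ h r := fun r hr => hc₀h r ⟨hr.1.le, hr.2⟩
  have h1 : ∀ r ∈ openIntervalTo r₁ R, 1 ≤ h r := fun r hr => hc₀.le.trans (hc₀h' r hr)
  have hc₁ : 0 < Real.log c₀ := Real.log_pos hc₀
  have hlog : ∀ r ∈ openIntervalTo r₁ R, Real.log c₀ ≤ Real.log (h r) := fun r hr =>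
    Real.log_le_log (by linarith) (hc₀h' r hr)
  -- The cap at 1 keeps the exponent `1 + ε` at most 2, as `exists_moment_bound` needs.
  set ε := min δ 1 with hεdef
  have hε : 0 < ε := lt_min hδ one_pos
  obtain ⟨E₁, d, D, hE₁o, hE₁s, hE₁m, hD, hdG, hE₁⟩ := exists_exceptional_set ha hne hr₁ hr₁R hc₁ hε
    (min_le_right _ _) h1 hlog hcont
  have hr0 : ∀ r ∈ openIntervalTo r₁ R, 0 < r := fun r hr => hr₁.trans hr.1
  have hG : ∀ r ∈ openIntervalTo r₁ R, 0 < moment a 0 r := fun r hr =>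
    moment_zero_pos ha hne (hr0 r hr) hr.2
  have hhpos : ∀ r ∈ openIntervalTo r₁ R, 0 < h r := fun r hr => one_pos.trans_le (h1 r hr)
  have hGmono : ∀ r s, r ∈ openIntervalTo r₁ R → s ∈ openIntervalTo r₁ R → r ≤ s →
      Real.log (moment a 0 r) ≤ Real.log (moment a 0 s) := fun r s hr hs hrs =>
    Real.log_le_log (hG r hr) (moment_zero_mono ha hs.2 (hr0 r hr).le hrs)
  have hμ₁ := maxTerm_pos ha hne hr₁ hr₁R
  have hinf := exists_le_mul_maxTerm ha hne hr₁ hr₁R h1 hmono hfin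
  obtain ⟨k₀, q, hk₀, hq, hqφ, hgrid⟩ := exists_grid
    (φ := fun r => Real.log (h r) + Real.log (moment a 0 r))
    ((hcont.log fun r hr => (hhpos r hr).ne').add
      (ContinuousOn.log (fun r hr => (hasDerivAt_moment ha 0 (hr0 r hr)
        hr.2).continuousAt.continuousWithinAt) fun r hr => (hG r hr).ne'))
    (fun r hr s hs hrs => add_le_add (Real.log_le_log (hhpos r hr) (hmono hr hs hrs))
      (hGmono r s hr hs hrs)) ⟨r₁', hne₁⟩ (fun B => by
      -- `h G ≥ h μ² ≥ h μ · μ(r₁)`, so `h μ → ∞` makes `log h + log G` unbounded.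
      obtain ⟨r, hr, hB⟩ := hinf (Real.exp B / maxTerm a r₁)
      refine ⟨r, hr, ?_⟩
      have hB := hB r ⟨le_rfl, hr.2⟩
      rw [← Real.log_mul (hhpos r hr).ne' (hG r hr).ne',
        Real.le_log_iff_exp_le (mul_pos (hhpos r hr) (hG r hr))]
      rw [div_le_iff₀ hμ₁] at hB
      have h2 := maxTerm_mono (ha r (hr0 r hr).le hr.2) hr₁.le hr.1.le
      have h3 := maxTerm_sq_le_moment ha (hr0 r hr).le hr.2
      have h4 := hhpos r hr
      calc _ ≤ h r * maxTerm a r * maxTerm a r₁ := hB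
        _ ≤ h r * maxTerm a r * maxTerm a r := by
          gcongr
          exact mul_nonneg h4.le (hμ₁.le.trans h2)
        _ = h r * maxTerm a r ^ 2 := by ring
        _ ≤ _ := by gcongr)
  obtain ⟨C, hC, hCbound⟩ := exists_modulus_bound (c := d) (δ := δ) hc₁ hD
    (Real.exp_pos (2 * c + 1)) hε (min_le_left _ _)
  obtain ⟨r₂, hr₂, hr₂Λ⟩ := hinf (Real.exp (Real.exp 1))
  refine ⟨E₁ ∪ ⋃ j, Set.Ioo (leftPoint h (k₀ + j) (q j)) (q j) ∩ openIntervalTo r₁ R,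
    hE₁o.union (isOpen_iUnion fun j => isOpen_Ioo.inter (isOpen_openIntervalTo r₁ R)),
    Set.union_subset (hE₁s.trans hsub0)
      (Set.iUnion_subset fun j => Set.inter_subset_right.trans hsub0),
    hLogMeasure_union_lt_top (hE₁m ρ) (hLogMeasure_iUnion_Ioo_lt_top hr₁ hk₀ hmono h1 hq),
    C, hC, ?_⟩
  filter_upwards [ae_eventually_norm_tsum_le hX_meas hX_indep hX hX_int ha hne hk₀
    (fun j => ⟨hr0 _ (hq j), (hq j).2, h1 _ (hq j)⟩)] with ω hω
  obtain ⟨J, hJ⟩ := eventually_atTop.1 hω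
  have hr₀mem : max (q J) r₂ ∈ openIntervalTo r₁ R := by
    rcases max_choice (q J) r₂ with hmax | hmax <;> rw [hmax]
    exacts [hq J, hr₂]
  refine ⟨max (q J) r₂, hρr₁.trans hr₀mem.1, hr₀mem.2, fun r hr hrE => ?_⟩
  have hr' : r ∈ openIntervalTo r₁ R := ⟨hr₀mem.1.trans_le hr.1, hr.2⟩
  obtain ⟨j, hJj, hrj, hjφ⟩ := hgrid J r ((le_max_left _ _).trans hr.1) hr.2
  have hrs : r ≤ leftPoint h (k₀ + j) (q j) := by
    by_contra hcon
    exact hrE (Or.inr (Set.mem_iUnion.2 ⟨j, ⟨not_le.1 hcon, hrj⟩, hr'⟩))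
  have hμ := maxTerm_pos ha hne (hr0 r hr') hr.2
  have hΛ : Real.exp 1 ≤ Real.log (h r * maxTerm a r) :=
    (Real.le_log_iff_exp_le (mul_pos (hhpos r hr') hμ)).2
      (hr₂Λ r ⟨(le_max_right _ _).trans hr.1, hr.2⟩)
  obtain ⟨hl, hGD⟩ := hE₁ r hr' (fun hE => hrE (Or.inl hE)) hΛ
  have hk1 : (1 : ℝ) ≤ ((k₀ + j : ℕ) : ℝ) := by
    exact_mod_cast (by omega : 1 ≤ k₀ + j)
  have hφj := hqφ j
  have hlogG := hGmono r (q j) hr' (hq j) hrj.le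
  have hlogh := Real.log_le_log (hhpos r hr') (hmono hr' (hq j) hrj.le)
  have hhq := hhpos _ (hq j)
  have hlogp : 0 ≤ Real.log (((k₀ + j : ℕ) : ℝ) ^ 4 * h (q j)) :=
    Real.log_nonneg (one_le_mul_of_one_le_of_one_le (one_le_pow₀ hk1) (h1 _ (hq j)))
  refine hCbound (h r) (maxTerm a r) (moment a 0 r) (moment a 0 (q j)) (h (q j)) _
    ((k₀ + j : ℕ) : ℝ) _ (hG r hr') (h1 r hr') (hlog r hr') hμ (hdG r hr') hΛ hl hGD
    (by linarith) hjφ (by linarith) (Nat.cast_nonneg _) ?_ ?_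
    (maxModulus_le (hr0 r hr').le fun z hz => hJ j hJj z (hz.le.trans hrs))
  · have h2 := (Nat.ceil_lt_add_one hlogp).le
    rw [Real.log_mul (by positivity) hhq.ne', Real.log_pow] at h2
    push_cast at h2 ⊢
    rw [Real.log_mul (by positivity) hhq.ne', Real.log_pow]
    push_cast
    exact h2
  -- The sum `log h + log G` rises by at most 1 from `r` to `q j` and both summands increase, so
  -- each rises by at most 1.
  · rw [← Real.log_le_log_iff (hG _ (hq j)) (mul_pos (Real.exp_pos 1) (hG r hr')),
      Real.log_mul (Real.exp_pos 1).ne' (hG r hr').ne', Real.log_exp]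
    linarith
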